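/- Let $d\in\{2,3\}$ and let $\Omega\subset\mathbb R^d$ be a bounded domain with volume $C_m=|\Omega|$. Let $\rho_\pm,\eta_\pm,Re,We,Pe,Cn,Fr>0$, and put $$\alpha=\tfrac{\rho_+-\rho_-}{2\rho_+},\qquad \rho(\phi)=\alpha\phi+\tfrac{\rho_++\rho_-}{2\rho_+},\qquad \eta(\phi)=\tfrac{\eta_+-\eta_-}{2\eta_+}\phi+\tfrac{\eta_++\eta_-}{2\eta_+},\qquad \psi(\phi)=\tfrac14(\phi^2-1)^2 .$$ Let $y=x_2$, let $\hat g=-\nabla y$, and let $(\cdot,\cdot)$ be the $L^2(\Omega)$ pairing; repeated indices are summed. Let $\delta t>0$, $v^k,v^{k+1}\in H^1_0(\Omega)^d$ and $p^k,p^{k+1},\phi^k,\phi^{k+1},\mu^k,\mu^{k+1}\in H^1(\Omega)$. Write $\tilde u=\frac12(u^k+u^{k+1})$ for $u\in\{v,p,\phi,\mu\}$, and $\tilde\rho=\rho(\tilde\phi)$, $\tilde\eta=\eta(\tilde\phi)$, $\tilde J_i=\frac{\rho_--\rho_+}{2\rho_+Cn}\,\partial_i\tilde\mu$. Suppose that these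 functions satisfy the Crank–Nicolson-type scheme: for all $w\in H_0^1(\Omega)^d$ and $q\in H^1(\Omega)$, $$\Big(w_i,\tilde\rho\,\tfrac{v_i^{k+1}-v_i^k}{\delta t}\Big)+\big(w_i,\tilde\rho\,\tilde v_j\partial_j\tilde v_i\big)+\tfrac1{Pe}\big(w_i,\tilde J_j\partial_j\tilde v_i\big)-\tfrac{Cn}{We}\big(\partial_jw_i,\partial_i\tilde\phi\,\partial_j\tilde\phi\big)-\tfrac1{We}\big(\partial_iw_i,\tilde p\big)+\tfrac1{Re}\big(\partial_jw_i,\tilde\eta\,\partial_j\tilde v_i\big)-\Big(w_i,\tfrac{\tilde\rho\,\hat g_i}{Fr}\Big)=0,$$ $$(q,\partial_iv_i^{k+1})=0,\qquad -(q,\tilde\mu)+(q,\psi'(\tilde\phi))+Cn^2(\partial_iq,\partial_i\tilde\phi)=0,$$ $$\Big(q,\tfrac{\phi^{k+1}-\phi^k}{\delta t}\Big)-(\partial_iq,\tilde v_i\tilde\phi)+\tfrac1{Pe\,Cn}(\partial_iq,\partial_i\tilde\mu)=0 .$$ It is understood that all pairings are defined: $\partial_i\tilde\phi\,\partial_j\tilde\phi$,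 $\tilde\eta\,\partial_j\tilde v_i$, $\psi'(\tilde\phi)$ and $\tilde v_i\tilde\phi$ lie in $L^2(\Omega)$, and $w_i\tilde\rho\,\tilde v_j\partial_j\tilde v_i$ and $w_i\tilde J_j\partial_j\tilde v_i$ are integrable for every $w\in H^1_0(\Omega)^d$. Assume also that $\psi(\phi^k)$ and $\psi(\phi^{k+1})$ are integrable, that $v^k$ is solenoidal, i.e. $(q,\partial_iv_i^k)=0$ for all $q\in H^1(\Omega)$, and that there is no net flux of $\tilde J$ in the direction of gravity, $\int_\Omega \tilde J_i\hat g_i\,dx=0$ (in boundary form, $\frac{\rho_--\rho_+}{2\rho_+Cn}\int_{\partial\Omega}\tilde\mu\,\hat g\cdot\hat n\,dS=0$). Put $$E_{tot}(v,\phi)=\frac12\int_\Omega\rho(\phi)|v|^2\,dx+\frac1{Cn\,We}\int_\Omega\Big(\psi(\phi)+\frac{Cn^2}2|\nabla\phi|^2\Big)dx+\frac1{Fr}\int_\Omega\rho(\phi)\,y\,dx,$$ $$N_v=\int_\Omega\tilde\eta\,\|\nabla\tilde v\|_F^2\,dx\ \big(=\|\sqrt{\tilde\eta}\,\nabla\tilde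 v\|_{L^2}^2\text{ when }\tilde\eta\ge0\big),\qquad N_\mu=\|\nabla\tilde\mu\|_{L^2}^2 .$$ **Theorem.** There is a function $\lambda$ on $\Omega$ with values $\lambda(x)$ between $\phi^k(x)$ and $\phi^{k+1}(x)$, such that $\psi(\phi^{k+1})-\psi(\phi^k)=\psi'(\tilde\phi)(\phi^{k+1}-\phi^k)+\frac1{24}\psi'''(\lambda)(\phi^{k+1}-\phi^k)^3$ pointwise in $\Omega$, all integrals below and in the two energies converge, and the following hold. (1) Energy law: $$E_{tot}(v^{k+1},\phi^{k+1})-E_{tot}(v^k,\phi^k)=-\frac{\delta t}{Re}N_v-\frac{\delta t}{Pe\,Cn^2We}N_\mu+\frac1{24\,We\,Cn}\int_\Omega\psi'''(\lambda)(\phi^{k+1}-\phi^k)^3dx+\frac18\int_\Omega[\rho(\phi^{k+1})-\rho(\phi^k)]\,|v^{k+1}-v^k|^2dx .$$ (2) Energy stability: let $L_\phi,L_v,P_{\max}$ be real constants such that, for almost every $x\in\Omega$, $|\phi^{k+1}-\phi^k|\le L_\phi\,\delta t$, $|v^{k+1}-v^k|\le L_v\,\delta t$ and $\frac1{24}|\psi'''(\lambda)|\le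 P_{\max}$. Put $$N=\frac1{Re}N_v+\frac1{Pe\,Cn^2We}N_\mu,\qquad D=\frac{C_mL_\phi^3P_{\max}}{We\,Cn}+\frac{C_m|\alpha|L_\phi L_v^2}8 .$$ If $N\ge0$ (automatic when $\tilde\eta\ge0$) and $\delta t\le(N/D)^{1/2}$ (no restriction when $D=0$), then $E_{tot}(v^{k+1},\phi^{k+1})\le E_{tot}(v^k,\phi^k)$. -/

import Mathlib

open MeasureTheory Filter Topology
open scoped ContDiff

noncomputable section

namespace CHNS

/-- Euclidean space `ℝ^d`. -/
abbrev Eu (d : ℕ) : Type := EuclideanSpace ℝ (Fin d)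

/-- Classical partial derivative `∂f/∂x_i`. -/
def pderiv {d : ℕ} (i : Fin d) (f : Eu d → ℝ) (x : Eu d) : ℝ :=
  fderiv ℝ f x (EuclideanSpace.single i 1)

/-- Test functions: the elements of `C_c^∞(Ω)`. -/
structure IsTestFunction {d : ℕ} (Ω : Set (Eu d)) (ζ : Eu d → ℝ) : Prop where
  smooth : ContDiff ℝ ∞ ζ
  compact : HasCompactSupport ζ
  supp : tsupport ζ ⊆ Ω

/-- The Sobolev space `H¹(Ω)`: a square integrable function together with its weak gradient,
which is square integrable. (The weak gradient is unique almost everywhere in `Ω`.) -/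
structure H1 {d : ℕ} (Ω : Set (Eu d)) where
  toFun : Eu d → ℝ
  grad : Fin d → Eu d → ℝ
  memLp : MemLp toFun 2 (volume.restrict Ω)
  memLp_grad : ∀ i, MemLp (grad i) 2 (volume.restrict Ω)
  weak : ∀ ζ : Eu d → ℝ, IsTestFunction Ω ζ → ∀ i,
    ∫ x in Ω, toFun x * pderiv i ζ x = -∫ x in Ω, grad i x * ζ x

instance {d : ℕ} (Ω : Set (Eu d)) : CoeFun (H1 Ω) (fun _ => Eu d → ℝ) := ⟨H1.toFun⟩

/-- `u ∈ H¹₀(Ω)`: `u` is a limit of test functions in the norm of `H¹(Ω)`. -/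
def H1.IsZeroTrace {d : ℕ} {Ω : Set (Eu d)} (u : H1 Ω) : Prop :=
  ∃ ζ : ℕ → Eu d → ℝ, (∀ n, IsTestFunction Ω (ζ n)) ∧
    Tendsto (fun n => eLpNorm (fun x => u x - ζ n x) 2 (volume.restrict Ω)) atTop (𝓝 0) ∧
    ∀ i, Tendsto (fun n => eLpNorm (fun x => u.grad i x - pderiv i (ζ n) x) 2
      (volume.restrict Ω)) atTop (𝓝 0)

theorem IsTestFunction.continuous_pderiv {d : ℕ} {Ω : Set (Eu d)} {ζ : Eu d → ℝ}
    (h : IsTestFunction Ω ζ) (i : Fin d) : Continuous (pderiv i ζ) :=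
  (h.smooth.continuous_fderiv (by simp)).clm_apply continuous_const

theorem IsTestFunction.memLp {d : ℕ} {Ω : Set (Eu d)} {ζ : Eu d → ℝ}
    (h : IsTestFunction Ω ζ) : MemLp ζ 2 (volume.restrict Ω) :=
  (h.smooth.continuous.memLp_of_hasCompactSupport h.compact).restrict Ω

theorem IsTestFunction.memLp_pderiv {d : ℕ} {Ω : Set (Eu d)} {ζ : Eu d → ℝ}
    (h : IsTestFunction Ω ζ) (i : Fin d) : MemLp (pderiv i ζ) 2 (volume.restrict Ω) :=
  ((h.continuous_pderiv i).memLp_of_hasCompactSupport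
    (h.compact.fderiv_apply ℝ (EuclideanSpace.single i 1))).restrict Ω

/-- The average `(u + v) / 2` in `H¹(Ω)`. -/
def H1.avg {d : ℕ} {Ω : Set (Eu d)} (u v : H1 Ω) : H1 Ω where
  toFun x := (u x + v x) / 2
  grad i x := (u.grad i x + v.grad i x) / 2
  memLp := by
    simpa [div_eq_inv_mul] using (u.memLp.add v.memLp).const_mul (2⁻¹ : ℝ)
  memLp_grad i := by
    simpa [div_eq_inv_mul] using ((u.memLp_grad i).add (v.memLp_grad i)).const_mul (2⁻¹ : ℝ)
  weak ζ hζ i := by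
    have e1 : ∀ x, (u x + v x) / 2 * pderiv i ζ x
        = 2⁻¹ * (u x * pderiv i ζ x + v x * pderiv i ζ x) := fun x => by ring
    have e2 : ∀ x, (u.grad i x + v.grad i x) / 2 * ζ x
        = 2⁻¹ * (u.grad i x * ζ x + v.grad i x * ζ x) := fun x => by ring
    simp only [e1, e2]
    have i1 : Integrable (fun x => u x * pderiv i ζ x) (volume.restrict Ω) :=
      u.memLp.integrable_mul (hζ.memLp_pderiv i)
    have i2 : Integrable (fun x => v x * pderiv i ζ x) (volume.restrict Ω) :=
      v.memLp.integrable_mul (hζ.memLp_pderiv i)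
    have i3 : Integrable (fun x => u.grad i x * ζ x) (volume.restrict Ω) :=
      (u.memLp_grad i).integrable_mul hζ.memLp
    have i4 : Integrable (fun x => v.grad i x * ζ x) (volume.restrict Ω) :=
      (v.memLp_grad i).integrable_mul hζ.memLp
    rw [integral_const_mul, integral_const_mul, integral_add i1 i2, integral_add i3 i4,
      u.weak ζ hζ i, v.weak ζ hζ i]
    ring

/-- The non-dimensional parameters of the model: specific densities and viscosities of the two
phases, and the Reynolds, Weber, Péclet, Cahn and Froude numbers. -/
structure Params where
  rhoP : ℝ
  rhoM : ℝ
  etaP : ℝ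
  etaM : ℝ
  Re : ℝ
  We : ℝ
  Pe : ℝ
  Cn : ℝ
  Fr : ℝ
  rhoP_pos : 0 < rhoP
  rhoM_pos : 0 < rhoM
  etaP_pos : 0 < etaP
  etaM_pos : 0 < etaM
  Re_pos : 0 < Re
  We_pos : 0 < We
  Pe_pos : 0 < Pe
  Cn_pos : 0 < Cn
  Fr_pos : 0 < Fr

/-- The slope `α` of the mixture density. -/
def Params.alpha (c : Params) : ℝ := (c.rhoP - c.rhoM) / (2 * c.rhoP)

/-- Mixture density `ρ(φ) = α φ + β`. -/
def Params.rho (c : Params) (s : ℝ) : ℝ := c.alpha * s + (c.rhoP + c.rhoM) / (2 * c.rhoP)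

/-- Mixture viscosity `η(φ) = γ φ + ξ`. -/
def Params.eta (c : Params) (s : ℝ) : ℝ :=
  (c.etaP - c.etaM) / (2 * c.etaP) * s + (c.etaP + c.etaM) / (2 * c.etaP)

/-- The double-well free energy density `ψ(φ) = (φ² - 1)² / 4`. -/
def psi (s : ℝ) : ℝ := (s ^ 2 - 1) ^ 2 / 4

/-- The direction of gravity, `ĝ = (0, -1)` or `(0, -1, 0)`. -/
def gravDir {d : ℕ} (i : Fin d) : ℝ := if (i : ℕ) = 1 then -1 else 0

/-- The height `y = x₂` (coordinates are indexed from `0`, so this is the one with index `1`). -/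
def height {d : ℕ} (x : Eu d) : ℝ := ∑ i : Fin d, if (i : ℕ) = 1 then x i else 0

/-- The unknowns at one time level: velocity in `H¹₀(Ω)^d`; pressure, phase field and chemical
potential in `H¹(Ω)`. -/
structure State {d : ℕ} (Ω : Set (Eu d)) where
  v : Fin d → H1 Ω
  v_zero : ∀ i, (v i).IsZeroTrace
  p : H1 Ω
  phi : H1 Ω
  mu : H1 Ω

/-- The velocity is weakly divergence free: `(q, ∂v_i/∂x_i) = 0` for all `q ∈ H¹(Ω)`. -/
def State.Solenoidal {d : ℕ} {Ω : Set (Eu d)} (s : State Ω) : Prop :=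
  ∀ q : H1 Ω, ∫ x in Ω, q x * ∑ i, (s.v i).grad i x = 0

section Step

variable {d : ℕ} {Ω : Set (Eu d)}

/-- Time-averaged velocity component `ṽ_i`. -/
def vMid (s s' : State Ω) (i : Fin d) : H1 Ω := (s.v i).avg (s'.v i)

/-- Time-averaged pressure. -/
def pMid (s s' : State Ω) : H1 Ω := s.p.avg s'.p

/-- Time-averaged phase field. -/
def phiMid (s s' : State Ω) : H1 Ω := s.phi.avg s'.phi

/-- Time-averaged chemical potential. -/
def muMid (s s' : State Ω) : H1 Ω := s.mu.avg s'.mu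

/-- The flux `J̃_i = (ρ₋ - ρ₊) / (2 ρ₊ Cn) ∂μ̃/∂x_i`. -/
def flux (c : Params) (s s' : State Ω) (i : Fin d) (x : Eu d) : ℝ :=
  (c.rhoM - c.rhoP) / (2 * c.rhoP * c.Cn) * (muMid s s').grad i x

/-- The pairings in the variational problem are defined. Those not listed here converge for all
functions of the spaces at hand: they pair two square integrable functions, or (the inertial and
the gravity term) follow from Sobolev's inequality in `H¹₀(Ω)`, `d ≤ 3`. -/
structure PairingsDefined (c : Params) (s s' : State Ω) : Prop where
  /-- the capillary stress, paired with `∂w_i/∂x_j` -/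
  capillary : ∀ i j, MemLp (fun x => (phiMid s s').grad i x * (phiMid s s').grad j x) 2
    (volume.restrict Ω)
  /-- the viscous stress, paired with `∂w_i/∂x_j` -/
  viscous : ∀ i j, MemLp (fun x => c.eta (phiMid s s' x) * (vMid s s' i).grad j x) 2
    (volume.restrict Ω)
  /-- the derivative of the potential, paired with `q` -/
  potential : MemLp (fun x => deriv psi (phiMid s s' x)) 2 (volume.restrict Ω)
  /-- the advective flux of the phase field, paired with `∂q/∂x_i` -/
  advective : ∀ i, MemLp (fun x => vMid s s' i x * phiMid s s' x) 2 (volume.restrict Ω)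
  /-- the convective term, paired with `w_i` -/
  convective : ∀ w : Fin d → H1 Ω, (∀ i, (w i).IsZeroTrace) →
    IntegrableOn (fun x => ∑ i, ∑ j, w i x *
      (c.rho (phiMid s s' x) * vMid s s' j x * (vMid s s' i).grad j x)) Ω
  /-- transport of momentum by the flux `J̃`, paired with `w_i` -/
  fluxTransport : ∀ w : Fin d → H1 Ω, (∀ i, (w i).IsZeroTrace) →
    IntegrableOn (fun x => ∑ i, ∑ j, w i x * (flux c s s' j x * (vMid s s' i).grad j x)) Ω

/-- `s'` is obtained from `s` by one step, of size `δt`, of the Crank-Nicolson-type scheme. -/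
structure IsStep (c : Params) (δt : ℝ) (s s' : State Ω) : Prop where
  defined : PairingsDefined c s s'
  momentum : ∀ w : Fin d → H1 Ω, (∀ i, (w i).IsZeroTrace) →
    (∫ x in Ω, ∑ i, w i x * (c.rho (phiMid s s' x) * ((s'.v i x - s.v i x) / δt)))
    + (∫ x in Ω, ∑ i, ∑ j, w i x *
        (c.rho (phiMid s s' x) * vMid s s' j x * (vMid s s' i).grad j x))
    + 1 / c.Pe * (∫ x in Ω, ∑ i, ∑ j, w i x * (flux c s s' j x * (vMid s s' i).grad j x))
    - c.Cn / c.We * (∫ x in Ω, ∑ i, ∑ j, (w i).grad j x *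
        ((phiMid s s').grad i x * (phiMid s s').grad j x))
    - 1 / c.We * (∫ x in Ω, ∑ i, (w i).grad i x * pMid s s' x)
    + 1 / c.Re * (∫ x in Ω, ∑ i, ∑ j, (w i).grad j x *
        (c.eta (phiMid s s' x) * (vMid s s' i).grad j x))
    - (∫ x in Ω, ∑ i, w i x * (c.rho (phiMid s s' x) * gravDir i / c.Fr)) = 0
  solenoidal : s'.Solenoidal
  chemicalPotential : ∀ q : H1 Ω,
    -(∫ x in Ω, q x * muMid s s' x) + (∫ x in Ω, q x * deriv psi (phiMid s s' x))
    + c.Cn ^ 2 * (∫ x in Ω, ∑ i, q.grad i x * (phiMid s s').grad i x) = 0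
  cahnHilliard : ∀ q : H1 Ω,
    (∫ x in Ω, q x * ((s'.phi x - s.phi x) / δt))
    - (∫ x in Ω, ∑ i, q.grad i x * (vMid s s' i x * phiMid s s' x))
    + 1 / (c.Pe * c.Cn) * (∫ x in Ω, ∑ i, q.grad i x * (muMid s s').grad i x) = 0

/-- The total energy: kinetic energy, free energy and gravitational potential energy. -/
def totalEnergy (c : Params) (s : State Ω) : ℝ :=
  1 / 2 * (∫ x in Ω, c.rho (s.phi x) * ∑ i, s.v i x ^ 2)
  + 1 / (c.Cn * c.We) * (∫ x in Ω, (psi (s.phi x) + c.Cn ^ 2 / 2 * ∑ i, s.phi.grad i x ^ 2))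
  + 1 / c.Fr * (∫ x in Ω, c.rho (s.phi x) * height x)

/-- All the integrals in the total energy converge. -/
def EnergyDefined (c : Params) (s : State Ω) : Prop :=
  IntegrableOn (fun x => c.rho (s.phi x) * ∑ i, s.v i x ^ 2) Ω ∧
  IntegrableOn (fun x => psi (s.phi x) + c.Cn ^ 2 / 2 * ∑ i, s.phi.grad i x ^ 2) Ω ∧
  IntegrableOn (fun x => c.rho (s.phi x) * height x) Ω

/-- `‖√η̃ ∇ṽ‖²` in `L²(Ω)`, with the Frobenius norm of `∇ṽ`. -/
def viscousNormSq (c : Params) (s s' : State Ω) : ℝ :=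
  ∫ x in Ω, c.eta (phiMid s s' x) * ∑ i, ∑ j, (vMid s s' i).grad j x ^ 2

/-- `‖∇μ̃‖²` in `L²(Ω)`. -/
def potentialNormSq (s s' : State Ω) : ℝ :=
  ∫ x in Ω, ∑ i, (muMid s s').grad i x ^ 2

/-- The integrand of the cubic Taylor remainder, `ψ'''(λ) (φ^{k+1} - φ^k)³`. -/
def cubicTerm (s s' : State Ω) (lam : Eu d → ℝ) (x : Eu d) : ℝ :=
  iteratedDeriv 3 psi (lam x) * (s'.phi x - s.phi x) ^ 3

/-- The integrand of the density-variation term, `[ρ(φ^{k+1}) - ρ(φ^k)] |v^{k+1} - v^k|²`. -/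
def densityTerm (c : Params) (s s' : State Ω) (x : Eu d) : ℝ :=
  (c.rho (s'.phi x) - c.rho (s.phi x)) * ∑ i, (s'.v i x - s.v i x) ^ 2

/-- Numerator in the time-step restriction. -/
def stepNum (c : Params) (s s' : State Ω) : ℝ :=
  1 / c.Re * viscousNormSq c s s' + 1 / (c.Pe * c.Cn ^ 2 * c.We) * potentialNormSq s s'

/-- Denominator in the time-step restriction, for a domain of volume `Cm` and constants
`Lphi`, `Lv`, `Pmax`. -/
def stepDen (c : Params) (Cm Lphi Lv Pmax : ℝ) : ℝ :=
  Cm * Lphi ^ 3 * Pmax / (c.We * c.Cn) + Cm * |c.alpha| * Lphi * Lv ^ 2 / 8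

end Step

end CHNS

end

/-!
The proof tests the momentum equation with `ṽ`, the Cahn-Hilliard equation with `μ̃`, and the
equation for the chemical potential with `φ^{k+1} - φ^k`. Averages at the midpoint make the
increments of the energies exact up to the two remainders in the energy law: the cubic term,
because `ψ` is quartic (so that `λ` may be taken to be `φ̃`), and the density term, from the product
`ρ |v|²`. The rest is the cancellation of three exchange terms. The test functions that give the
first two of them are not admissible as they stand.

* `kinetic_transport`: the mass balance tested with `|ṽ|² / 2`. This function is not in `H¹(Ω)`, but
  products of truncations of its factors are (`H1.comp`, `H1.mul`), and the assumed integrability of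
  the convective terms allows the passage to the limit (`H1.transport_mul`). The densities
  `φ |v|²` are integrable by Sobolev's inequality `H¹₀(Ω) ⊆ L⁴(Ω)` (`H1.IsZeroTrace.memLp_four`).
* `capillary_exchange`: formally, the equation for the chemical potential is tested with `ṽ ⋅ ∇φ̃`.
  As the weak Laplacian of `φ̃` is square integrable, the mollifications of `φ̃` satisfy the
  classical stress-energy identity with convergent right-hand sides, for a smooth field in place of
  `ṽ` (`H1.stress_identity_test`); as `∇φ̃ ⊗ ∇φ̃` is square integrable, the field may then tend to
  `ṽ` in `H¹(Ω)` and `L⁴(Ω)` (`H1.stress_identity`). The two remaining terms are treated by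
  truncation: `ṽ` does no work against `∇ψ(φ̃)` (`H1.integral_deriv_psi_mul`), and
  `μ̃ ∇φ̃ + φ̃ ∇μ̃` is a gradient (`H1.transport_mul` again).
* `gravity_exchange`: the mass balance tested with the height.

Energy stability follows since the two remainders are at most `δt³` times the denominator in the
restriction on the time step.
-/

/-! ### Mollification of square integrable functions -/

namespace CHNS

open scoped Convolution ENNReal

/-- A bump function on `ℝ^d` supported in the ball of radius `1 / (n + 1)`. -/
noncomputable def bump (d n : ℕ) : ContDiffBump (0 : Eu d) where
  rIn := 1 / (2 * (n + 1))
  rOut := 1 / (n + 1)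
  rIn_pos := by positivity
  rIn_lt_rOut := by
    have : (0 : ℝ) < n + 1 := by positivity
    rw [one_div_lt_one_div (by positivity) this]
    linarith

/-- The mollifying kernel: a bump function of integral one. -/
noncomputable def kernel (d n : ℕ) : Eu d → ℝ := (bump d n).normed volume

/-- The mollification of `f` at scale `1 / (n + 1)`. -/
noncomputable def mollify {d : ℕ} (n : ℕ) (f : Eu d → ℝ) : Eu d → ℝ :=
  kernel d n ⋆[ContinuousLinearMap.lsmul ℝ ℝ, volume] f

variable {d : ℕ}

theorem kernel_nonneg (n : ℕ) (x : Eu d) : 0 ≤ kernel d n x := (bump d n).nonneg_normed x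

theorem contDiff_kernel (n : ℕ) : ContDiff ℝ ∞ (kernel d n) := (bump d n).contDiff_normed

theorem continuous_kernel (n : ℕ) : Continuous (kernel d n) := (contDiff_kernel n).continuous

theorem hasCompactSupport_kernel (n : ℕ) : HasCompactSupport (kernel d n) :=
  (bump d n).hasCompactSupport_normed

theorem tsupport_kernel (n : ℕ) : tsupport (kernel d n) = Metric.closedBall 0 (1 / (n + 1)) :=
  (bump d n).tsupport_normed_eq

theorem integral_kernel (n : ℕ) : ∫ x, kernel d n x = 1 := (bump d n).integral_normed

theorem integrable_kernel (n : ℕ) : Integrable (kernel d n) :=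
  (continuous_kernel n).integrable_of_hasCompactSupport (hasCompactSupport_kernel n)

theorem mollify_apply (n : ℕ) (f : Eu d → ℝ) (x : Eu d) :
    mollify n f x = ∫ y, kernel d n (x - y) * f y := by
  simp [mollify, convolution_eq_swap]

theorem contDiff_mollify (n : ℕ) {f : Eu d → ℝ} (hf : LocallyIntegrable f) :
    ContDiff ℝ ∞ (mollify n f) :=
  (hasCompactSupport_kernel n).contDiff_convolution_left _ (contDiff_kernel n) hf

theorem tendsto_bump_rOut (d : ℕ) : Tendsto (fun n => (bump d n).rOut) atTop (𝓝 0) :=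
  tendsto_one_div_add_atTop_nhds_zero_nat

theorem ae_tendsto_mollify {f : Eu d → ℝ} (hf : LocallyIntegrable f) :
    ∀ᵐ x, Tendsto (fun n => mollify n f x) atTop (𝓝 (f x)) := by
  refine ContDiffBump.ae_convolution_tendsto_right_of_locallyIntegrable (K := 2)
    (tendsto_bump_rOut d) (Eventually.of_forall fun n => ?_) hf
  have : (0 : ℝ) < n + 1 := by positivity
  change (1 : ℝ) / (n + 1) ≤ 2 * (1 / (2 * (n + 1)))
  apply le_of_eq
  field_simp

theorem integrable_kernel_mul (n : ℕ) {f : Eu d → ℝ} (hf : LocallyIntegrable f) (x : Eu d) :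
    Integrable (fun y => kernel d n (x - y) * f y) := by
  have h : HasCompactSupport fun y => kernel d n (x - y) :=
    (hasCompactSupport_kernel n).comp_homeomorph (Homeomorph.subLeft x)
  have hc : Continuous fun y => kernel d n (x - y) :=
    (continuous_kernel n).comp (continuous_const.sub continuous_id)
  simpa using hf.integrable_smul_left_of_hasCompactSupport hc h

theorem integral_kernel_sub (n : ℕ) (x : Eu d) : ∫ y, kernel d n (x - y) = 1 := by
  rw [integral_sub_left_eq_self (fun y => kernel d n y) volume x, integral_kernel]

/-- Jensen's inequality for the averages `mollify n f`. -/
theorem sq_mollify_le (n : ℕ) {f : Eu d → ℝ} (hf : LocallyIntegrable f)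
    (hf2 : LocallyIntegrable fun x => f x ^ 2) (x : Eu d) :
    mollify n f x ^ 2 ≤ mollify n (fun y => f y ^ 2) x := by
  set m := mollify n f x with hm
  have i1 := integrable_kernel_mul n hf x
  have i2 := integrable_kernel_mul n hf2 x
  have i0 : Integrable (fun y => kernel d n (x - y)) := (integrable_kernel n).comp_sub_left x
  have h0 : 0 ≤ ∫ y, kernel d n (x - y) * (f y - m) ^ 2 :=
    integral_nonneg fun y => mul_nonneg (kernel_nonneg n _) (sq_nonneg _)
  have e : ∫ y, kernel d n (x - y) * (f y - m) ^ 2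
      = mollify n (fun y => f y ^ 2) x - 2 * m * m + m ^ 2 := by
    have : ∀ y, kernel d n (x - y) * (f y - m) ^ 2 = kernel d n (x - y) * f y ^ 2
        - 2 * m * (kernel d n (x - y) * f y) + m ^ 2 * kernel d n (x - y) := fun y => by ring
    simp only [this]
    have i3 : Integrable fun y =>
        kernel d n (x - y) * f y ^ 2 - 2 * m * (kernel d n (x - y) * f y) :=
      i2.sub (i1.const_mul _)
    rw [integral_add i3 (i0.const_mul _), integral_sub i2 (i1.const_mul _), integral_const_mul,
      integral_const_mul, integral_kernel_sub, ← mollify_apply, ← mollify_apply, ← hm]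
    ring
  nlinarith

theorem integrable_mollify (n : ℕ) {f : Eu d → ℝ} (hf : Integrable f) :
    Integrable (mollify n f) :=
  (integrable_kernel n).integrable_convolution _ hf

theorem integral_mollify (n : ℕ) {f : Eu d → ℝ} (hf : Integrable f) :
    ∫ x, mollify n f x = ∫ x, f x := by
  simp only [mollify]
  rw [integral_convolution _ (integrable_kernel n) hf, integral_kernel]
  simp

/-- A square integrable limit, with domination by a sequence of integrable functions whose
integrals converge to the right value: if `F n → f` almost everywhere, `(F n)² ≤ G n`, `G n → f²`
almost everywhere and `∫ G n = ∫ f²`, then `F n → f` in `L²`. -/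
theorem tendsto_integral_sq_sub {α : Type*} [MeasurableSpace α] {μ : Measure α}
    {F G : ℕ → α → ℝ} {f : α → ℝ} (hF : ∀ n, AEStronglyMeasurable (F n) μ)
    (hG : ∀ n, Integrable (G n) μ) (hf : MemLp f 2 μ)
    (hle : ∀ n x, F n x ^ 2 ≤ G n x) (hint : ∀ n, ∫ x, G n x ∂μ = ∫ x, f x ^ 2 ∂μ)
    (hFl : ∀ᵐ x ∂μ, Tendsto (fun n => F n x) atTop (𝓝 (f x)))
    (hGl : ∀ᵐ x ∂μ, Tendsto (fun n => G n x) atTop (𝓝 (f x ^ 2))) :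
    Tendsto (fun n => ∫ x, (F n x - f x) ^ 2 ∂μ) atTop (𝓝 0) := by
  have hf2 : Integrable (fun x => f x ^ 2) μ := hf.integrable_sq
  have hb : ∀ n x, (F n x - f x) ^ 2 ≤ 2 * G n x + 2 * f x ^ 2 := fun n x => by
    nlinarith [hle n x, sq_nonneg (F n x + f x)]
  have hD : ∀ n, Integrable (fun x => (F n x - f x) ^ 2) μ := fun n =>
    (((hG n).const_mul 2).add (hf2.const_mul 2)).mono' (((hF n).sub hf.1).pow 2)
      (Eventually.of_forall fun x => by
        simpa [abs_of_nonneg (sq_nonneg (F n x - f x))] using hb n x)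
  set I := ∫ x, f x ^ 2 ∂μ with hI
  -- Fatou's lemma for the nonnegative functions `2 G n + 2 f² - (F n - f)²`
  set A : ℕ → α → ℝ := fun n x => 2 * G n x + 2 * f x ^ 2 - (F n x - f x) ^ 2 with hA
  have hAint : ∀ n, Integrable (A n) μ := fun n =>
    (((hG n).const_mul 2).add (hf2.const_mul 2)).sub (hD n)
  have hAval : ∀ n, ∫ x, A n x ∂μ = 4 * I - ∫ x, (F n x - f x) ^ 2 ∂μ := fun n => by
    have i3 : Integrable (fun x => 2 * G n x + 2 * f x ^ 2) μ :=
      ((hG n).const_mul 2).add (hf2.const_mul 2)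
    simp only [hA]
    rw [integral_sub i3 (hD n),
      integral_add ((hG n).const_mul 2) (hf2.const_mul 2), integral_const_mul,
      integral_const_mul, hint n]
    ring
  have hA0 : ∀ n x, 0 ≤ A n x := fun n x => sub_nonneg.2 (hb n x)
  have hfatou : ENNReal.ofReal (4 * I) ≤
      atTop.liminf fun n => ENNReal.ofReal (4 * I - ∫ x, (F n x - f x) ^ 2 ∂μ) := by
    calc ENNReal.ofReal (4 * I) = ∫⁻ x, ENNReal.ofReal (4 * f x ^ 2) ∂μ := by
          rw [← ofReal_integral_eq_lintegral_ofReal (hf2.const_mul 4)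
            (Eventually.of_forall fun x => by positivity), integral_const_mul]
      _ = ∫⁻ x, atTop.liminf (fun n => ENNReal.ofReal (A n x)) ∂μ := by
          refine lintegral_congr_ae ?_
          filter_upwards [hFl, hGl] with x h1 h2
          refine (Tendsto.liminf_eq ?_).symm
          refine ENNReal.tendsto_ofReal ?_
          have := ((h2.const_mul 2).add_const (2 * f x ^ 2)).sub ((h1.sub_const (f x)).pow 2)
          convert this using 2
          ring
      _ ≤ atTop.liminf fun n => ∫⁻ x, ENNReal.ofReal (A n x) ∂μ :=
          lintegral_liminf_le' fun n => (hAint n).aemeasurable.ennreal_ofReal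
      _ = _ := by
          congr 1
          ext n
          rw [← hAval, ofReal_integral_eq_lintegral_ofReal (hAint n)
            (Eventually.of_forall (hA0 n))]
  have he0 : ∀ n, 0 ≤ ∫ x, (F n x - f x) ^ 2 ∂μ := fun n => integral_nonneg fun x => sq_nonneg _
  have he4 : ∀ n, ∫ x, (F n x - f x) ^ 2 ∂μ ≤ 4 * I := fun n => by
    have := integral_nonneg (μ := μ) (f := A n) (hA0 n)
    rw [hAval] at this
    linarith
  refine tendsto_order.2 ⟨fun a ha => Eventually.of_forall fun n => ha.trans_le (he0 n),
    fun ε hε => ?_⟩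
  by_cases h4 : 4 * I < ε
  · exact Eventually.of_forall fun n => (he4 n).trans_lt h4
  · have hlt : ENNReal.ofReal (4 * I - ε) < ENNReal.ofReal (4 * I) :=
      (ENNReal.ofReal_lt_ofReal_iff (by linarith)).2 (by linarith)
    filter_upwards [eventually_lt_of_lt_liminf (hlt.trans_le hfatou)] with n hn
    have := (ENNReal.ofReal_lt_ofReal_iff_of_nonneg (by linarith)).1 hn
    linarith

theorem _root_.MeasureTheory.MemLp.eLpNorm_two_eq {α : Type*} [MeasurableSpace α] {μ : Measure α}
    {f : α → ℝ} (hf : MemLp f 2 μ) :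
    eLpNorm f 2 μ = ENNReal.ofReal ((∫ x, f x ^ 2 ∂μ) ^ (1 / 2 : ℝ)) := by
  have := hf.eLpNorm_eq_integral_rpow_norm (by norm_num) (by norm_num)
  simpa using this

theorem memLp_mollify (n : ℕ) {f : Eu d → ℝ} (hf : MemLp f 2) : MemLp (mollify n f) 2 := by
  have hl : LocallyIntegrable f := hf.locallyIntegrable (by norm_num)
  rw [memLp_two_iff_integrable_sq (contDiff_mollify n hl).continuous.aestronglyMeasurable]
  refine (integrable_mollify n hf.integrable_sq).mono'
    ((contDiff_mollify n hl).continuous.pow 2).aestronglyMeasurable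
    (Eventually.of_forall fun x => ?_)
  simpa [abs_of_nonneg (sq_nonneg (mollify n f x))] using
    sq_mollify_le n hl hf.integrable_sq.locallyIntegrable x

theorem tendsto_eLpNorm_mollify {f : Eu d → ℝ} (hf : MemLp f 2) :
    Tendsto (fun n => eLpNorm (fun x => mollify n f x - f x) 2 volume) atTop (𝓝 0) := by
  have hl : LocallyIntegrable f := hf.locallyIntegrable (by norm_num)
  have hl2 := hf.integrable_sq.locallyIntegrable
  have key := tendsto_integral_sq_sub (μ := volume) (F := fun n => mollify n f)
    (G := fun n => mollify n fun x => f x ^ 2) (f := f)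
    (fun n => (contDiff_mollify n hl).continuous.aestronglyMeasurable)
    (fun n => integrable_mollify n hf.integrable_sq) hf
    (fun n x => sq_mollify_le n hl hl2 x)
    (fun n => integral_mollify n hf.integrable_sq)
    (ae_tendsto_mollify hl) (ae_tendsto_mollify hl2)
  have : ∀ n, eLpNorm (fun x => mollify n f x - f x) 2 volume
      = ENNReal.ofReal ((∫ x, (mollify n f x - f x) ^ 2) ^ (1 / 2 : ℝ)) := fun n =>
    ((memLp_mollify n hf).sub hf).eLpNorm_two_eq
  simp only [this]
  have h := ENNReal.tendsto_ofReal (key.rpow_const (p := 1 / 2) (Or.inr (by norm_num)))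
  simpa using h

/-- Derivatives of a mollification fall on the kernel. -/
theorem pderiv_mollify (n : ℕ) {f : Eu d → ℝ} (hf : LocallyIntegrable f) (i : Fin d) (x : Eu d) :
    pderiv i (mollify n f) x = -∫ y, pderiv i (fun z => kernel d n (x - z)) y * f y := by
  have h1 := (hasCompactSupport_kernel (d := d) n).hasFDerivAt_convolution_left
    (ContinuousLinearMap.lsmul ℝ ℝ) ((contDiff_kernel n).of_le (by simp)) hf x
  have hp : ∀ y, pderiv i (fun z => kernel d n (x - z)) y = -pderiv i (kernel d n) (x - y) := by
    intro y
    have h2 : HasFDerivAt (kernel d n) (fderiv ℝ (kernel d n) (x - y)) (x - y) :=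
      ((contDiff_kernel n).differentiable (by simp) _).hasFDerivAt
    have h3 := h2.comp y ((hasFDerivAt_id y).const_sub x)
    have h4 : fderiv ℝ (fun z => kernel d n (x - z)) y = _ := h3.fderiv
    simp [pderiv, h4]
  simp only [hp, neg_mul, integral_neg, neg_neg]
  have h2 : fderiv ℝ (mollify n f) x = _ := h1.fderiv
  rw [pderiv, h2, convolution_eq_swap]
  rw [ContinuousLinearMap.integral_apply]
  · rfl
  · have hc : Continuous (fderiv ℝ (kernel d n)) := (contDiff_kernel n).continuous_fderiv (by simp)
    have := ((hasCompactSupport_kernel (d := d) n).fderiv (𝕜 := ℝ)).convolutionExists_left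
      (ContinuousLinearMap.precompL (Eu d) (ContinuousLinearMap.lsmul ℝ ℝ)) hc hf x
    exact this.integrable_swap

end CHNS

/-! ### Convergence in the mean of order `p` -/

namespace CHNS

open scoped ENNReal

/-- Convergence in `L^p(μ)` of a sequence of functions, all of them and the limit being in
`L^p(μ)`. -/
structure LpTendsto {α : Type*} [MeasurableSpace α] (p : ℝ≥0∞) (μ : Measure α)
    (F : ℕ → α → ℝ) (f : α → ℝ) : Prop where
  memLp_seq : ∀ n, MemLp (F n) p μ
  memLp : MemLp f p μ
  tendsto : Tendsto (fun n => eLpNorm (fun x => F n x - f x) p μ) atTop (𝓝 0)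

namespace LpTendsto

variable {α : Type*} [MeasurableSpace α] {p : ℝ≥0∞} {μ : Measure α} {F G : ℕ → α → ℝ}
  {f g : α → ℝ}

theorem const (hf : MemLp f p μ) : LpTendsto p μ (fun _ => f) f :=
  ⟨fun _ => hf, hf, by simp⟩

theorem add [Fact (1 ≤ p)] (hF : LpTendsto p μ F f) (hG : LpTendsto p μ G g) :
    LpTendsto p μ (fun n x => F n x + G n x) (fun x => f x + g x) := by
  refine ⟨fun n => (hF.memLp_seq n).add (hG.memLp_seq n), hF.memLp.add hG.memLp, ?_⟩
  have h0 := hF.tendsto.add hG.tendsto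
  rw [add_zero] at h0
  refine tendsto_of_tendsto_of_tendsto_of_le_of_le tendsto_const_nhds h0 (fun _ => zero_le)
    fun n => ?_
  refine le_trans (le_of_eq ?_) (eLpNorm_add_le (μ := μ) (p := p)
    ((hF.memLp_seq n).sub hF.memLp).1 ((hG.memLp_seq n).sub hG.memLp).1 Fact.out)
  congr 1
  ext x
  simp only [Pi.add_apply]
  ring

theorem of_abs_sub_le {C : ℝ} (hG : LpTendsto p μ G g) (hF : ∀ n, MemLp (F n) p μ)
    (hf : MemLp f p μ) (h : ∀ n x, |F n x - f x| ≤ C * |G n x - g x|) : LpTendsto p μ F f := by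
  refine ⟨hF, hf, ?_⟩
  have h0 := ENNReal.Tendsto.const_mul hG.tendsto (a := ENNReal.ofReal C)
    (Or.inr ENNReal.ofReal_ne_top)
  rw [mul_zero] at h0
  exact tendsto_of_tendsto_of_tendsto_of_le_of_le tendsto_const_nhds h0 (fun _ => zero_le)
    fun n => eLpNorm_le_mul_eLpNorm_of_ae_le_mul (Eventually.of_forall (h n)) p

theorem mul_bounded {C : ℝ} (hF : LpTendsto p μ F f) (hg : AEStronglyMeasurable g μ)
    (hC : ∀ x, |g x| ≤ C) : LpTendsto p μ (fun n x => F n x * g x) (fun x => f x * g x) := by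
  have hm : ∀ {h : α → ℝ}, MemLp h p μ → MemLp (fun x => h x * g x) p μ := fun hh =>
    hh.of_le_mul (c := C) (hh.1.mul hg) (Eventually.of_forall fun x => by
      rw [Real.norm_eq_abs, Real.norm_eq_abs, abs_mul, mul_comm]
      exact mul_le_mul_of_nonneg_right (hC x) (abs_nonneg _))
  refine hF.of_abs_sub_le (C := C) (fun n => hm (hF.memLp_seq n)) (hm hF.memLp) fun n x => ?_
  rw [← sub_mul, abs_mul, mul_comm]
  exact mul_le_mul_of_nonneg_right (hC x) (abs_nonneg _)

theorem const_mul (c : ℝ) (hF : LpTendsto p μ F f) :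
    LpTendsto p μ (fun n x => c * F n x) (fun x => c * f x) :=
  hF.of_abs_sub_le (C := |c|) (fun n => (hF.memLp_seq n).const_mul c) (hF.memLp.const_mul c)
    fun n x => by rw [← mul_sub, abs_mul]

theorem tendsto_integral_mul (hF : LpTendsto 2 μ F f) (hG : LpTendsto 2 μ G g) :
    Tendsto (fun n => ∫ x, F n x * G n x ∂μ) atTop (𝓝 (∫ x, f x * g x ∂μ)) := by
  have h1 := (Lp.tendsto_Lp_iff_tendsto_eLpNorm'' F hF.memLp_seq f hF.memLp).2 hF.tendsto
  have h2 := (Lp.tendsto_Lp_iff_tendsto_eLpNorm'' G hG.memLp_seq g hG.memLp).2 hG.tendsto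
  have e : ∀ {a b : α → ℝ} (ha : MemLp a 2 μ) (hb : MemLp b 2 μ),
      inner ℝ (ha.toLp a) (hb.toLp b) = ∫ x, a x * b x ∂μ := fun ha hb => by
    rw [L2.inner_def]
    refine integral_congr_ae ?_
    filter_upwards [ha.coeFn_toLp, hb.coeFn_toLp] with x h1 h2
    rw [h1, h2]
    simp [mul_comm]
  have h3 := Filter.Tendsto.inner (𝕜 := ℝ) h1 h2
  simpa only [e] using h3

/-- Hölder's inequality for exponents `4, 4, 2`. -/
theorem mul_memLp_four (hF : LpTendsto 4 μ F f) (hg : MemLp g 4 μ) :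
    LpTendsto 2 μ (fun n x => F n x * g x) (fun x => f x * g x) := by
  have : ENNReal.HolderTriple 4 4 2 := ⟨by
    rw [← two_mul, show (4 : ℝ≥0∞) = 2 * 2 by norm_num,
      ENNReal.mul_inv (by simp) (by simp), ← mul_assoc, ENNReal.mul_inv_cancel (by simp) (by simp),
      one_mul]⟩
  refine ⟨fun n => hg.mul' (hF.memLp_seq n), hg.mul' hF.memLp, ?_⟩
  have h0 := ENNReal.Tendsto.mul_const hF.tendsto (b := eLpNorm g 4 μ)
    (Or.inr hg.eLpNorm_lt_top.ne)
  rw [zero_mul] at h0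
  refine tendsto_of_tendsto_of_tendsto_of_le_of_le tendsto_const_nhds h0 (fun _ => zero_le)
    fun n => ?_
  have := eLpNorm_smul_le_mul_eLpNorm (p := 4) (q := 4) (r := 2) hg.1
    ((hF.memLp_seq n).sub hF.memLp).1
  refine le_trans (le_of_eq ?_) this
  congr 1
  ext x
  simp [sub_mul]

/-- Dominated convergence in `L²`. -/
theorem of_dominated {b : α → ℝ} (hF : ∀ n, AEStronglyMeasurable (F n) μ) (hb : MemLp b 2 μ)
    (hle : ∀ n x, |F n x| ≤ |b x|)
    (hl : ∀ᵐ x ∂μ, Tendsto (fun n => F n x) atTop (𝓝 (f x))) : LpTendsto 2 μ F f := by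
  have hfm : AEStronglyMeasurable f μ := aestronglyMeasurable_of_tendsto_ae atTop hF hl
  have hfb : ∀ᵐ x ∂μ, |f x| ≤ |b x| := by
    filter_upwards [hl] with x hx
    exact le_of_tendsto hx.abs (Eventually.of_forall fun n => hle n x)
  have hFm : ∀ n, MemLp (F n) 2 μ := fun n => hb.mono (hF n) (Eventually.of_forall (hle n))
  have hf : MemLp f 2 μ := hb.mono hfm hfb
  refine ⟨hFm, hf, ?_⟩
  have key : Tendsto (fun n => ∫ x, (F n x - f x) ^ 2 ∂μ) atTop (𝓝 (∫ _, (0 : ℝ) ∂μ)) := by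
    refine tendsto_integral_of_dominated_convergence (fun x => 4 * b x ^ 2)
      (fun n => ((hF n).sub hfm).pow 2) (hb.integrable_sq.const_mul 4) (fun n => ?_) ?_
    · filter_upwards [hfb] with x hx
      have h1 := hle n x
      rw [Real.norm_eq_abs, abs_of_nonneg (sq_nonneg _)]
      have h2 : |F n x - f x| ≤ |2 * b x| := by
        rw [abs_mul, abs_two]
        exact (abs_sub _ _).trans (by linarith)
      have h3 := sq_le_sq.2 h2
      linarith
    · filter_upwards [hl] with x hx
      simpa using (hx.sub_const (f x)).pow 2
  have h := ENNReal.tendsto_ofReal (key.rpow_const (p := 1 / 2) (Or.inr (by norm_num)))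
  have e : ∀ n, eLpNorm (fun x => F n x - f x) 2 μ
      = ENNReal.ofReal ((∫ x, (F n x - f x) ^ 2 ∂μ) ^ (1 / 2 : ℝ)) := fun n =>
    ((hFm n).sub hf).eLpNorm_two_eq
  simp only [e]
  simpa using h

end LpTendsto

/-! ### Test functions -/

variable {d : ℕ} {Ω : Set (Eu d)}

theorem pderiv_mul {f g : Eu d → ℝ} {x : Eu d} (hf : DifferentiableAt ℝ f x)
    (hg : DifferentiableAt ℝ g x) (i : Fin d) :
    pderiv i (fun y => f y * g y) x = pderiv i f x * g x + f x * pderiv i g x := by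
  simp only [pderiv]
  rw [fderiv_fun_mul hf hg]
  simp
  ring

theorem pderiv_comp {T : ℝ → ℝ} {f : Eu d → ℝ} {x : Eu d} (hT : DifferentiableAt ℝ T (f x))
    (hf : DifferentiableAt ℝ f x) (i : Fin d) :
    pderiv i (fun y => T (f y)) x = deriv T (f x) * pderiv i f x := by
  have h := (hT.hasDerivAt.comp_hasFDerivAt x hf.hasFDerivAt).fderiv
  have h' : fderiv ℝ (fun y => T (f y)) x = deriv T (f x) • fderiv ℝ f x := h
  simp [pderiv, h']

theorem pderiv_congr {f g : Eu d → ℝ} {x : Eu d} (h : f =ᶠ[𝓝 x] g) (i : Fin d) :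
    pderiv i f x = pderiv i g x := by
  rw [pderiv, pderiv, h.fderiv_eq]

theorem continuous_pderiv {f : Eu d → ℝ} (hf : ContDiff ℝ 1 f) (i : Fin d) :
    Continuous (pderiv i f) :=
  (hf.continuous_fderiv (by simp)).clm_apply continuous_const

theorem contDiff_pderiv {f : Eu d → ℝ} (hf : ContDiff ℝ ∞ f) (i : Fin d) :
    ContDiff ℝ ∞ (pderiv i f) :=
  (hf.fderiv_right (m := ∞) (by simp)).clm_apply contDiff_const

/-- The integral of a derivative of a compactly supported function vanishes. -/
theorem integral_pderiv_eq_zero {g : Eu d → ℝ} (hg : ContDiff ℝ 1 g) (hc : HasCompactSupport g)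
    (i : Fin d) : ∫ x, pderiv i g x = 0 := by
  have hI : Integrable (pderiv i g) := (continuous_pderiv hg i).integrable_of_hasCompactSupport
    (hc.fderiv_apply ℝ _)
  have h := integral_mul_fderiv_eq_neg_fderiv_mul_of_integrable (μ := volume)
    (f := fun _ : Eu d => (1 : ℝ)) (g := g) (v := EuclideanSpace.single i 1) (by simp)
    (by simp only [one_mul]; exact hI)
    (by simpa using hg.continuous.integrable_of_hasCompactSupport hc)
    (fun x _ => differentiableAt_const _) fun x _ => hg.differentiable (by simp) x
  simpa [pderiv] using h

theorem pderiv_eq_zero_of_notMem {g : Eu d → ℝ} {x : Eu d} (hx : x ∉ tsupport g) (i : Fin d) :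
    pderiv i g x = 0 := by
  have : x ∉ Function.support (fderiv ℝ g) := fun h => hx (support_fderiv_subset ℝ h)
  simp [pderiv, Function.notMem_support.1 this]

theorem setIntegral_pderiv_eq_zero {g : Eu d → ℝ} (hg : ContDiff ℝ 1 g)
    (hc : HasCompactSupport g) (hs : tsupport g ⊆ Ω) (i : Fin d) :
    ∫ x in Ω, pderiv i g x = 0 := by
  rw [setIntegral_eq_integral_of_forall_compl_eq_zero fun x hx =>
    pderiv_eq_zero_of_notMem (fun h => hx (hs h)) i, integral_pderiv_eq_zero hg hc]

namespace IsTestFunction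

variable {ζ ξ : Eu d → ℝ}

theorem continuous (h : IsTestFunction Ω ζ) : Continuous ζ := h.smooth.continuous

theorem differentiable (h : IsTestFunction Ω ζ) : Differentiable ℝ ζ :=
  h.smooth.differentiable (by simp)

theorem eq_zero_of_notMem {x : Eu d} (hx : x ∉ tsupport ζ) : ζ x = 0 :=
  image_eq_zero_of_notMem_tsupport hx

theorem mul_smooth {g : Eu d → ℝ} (h : IsTestFunction Ω ζ) (hg : ContDiff ℝ ∞ g) :
    IsTestFunction Ω fun x => ζ x * g x :=
  ⟨h.smooth.mul hg, h.compact.mul_right, (tsupport_mul_subset_left (f := ζ) (g := g)).trans h.supp⟩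

theorem sub (h : IsTestFunction Ω ζ) (h' : IsTestFunction Ω ξ) :
    IsTestFunction Ω fun x => ζ x - ξ x :=
  ⟨h.smooth.sub h'.smooth, h.compact.sub h'.compact,
    (tsupport_sub ζ ξ).trans (Set.union_subset h.supp h'.supp)⟩

theorem add (h : IsTestFunction Ω ζ) (h' : IsTestFunction Ω ξ) :
    IsTestFunction Ω fun x => ζ x + ξ x :=
  ⟨h.smooth.add h'.smooth, h.compact.add h'.compact,
    (tsupport_add ζ ξ).trans (Set.union_subset h.supp h'.supp)⟩

theorem zero : IsTestFunction Ω fun _ => (0 : ℝ) :=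
  ⟨contDiff_const, HasCompactSupport.zero, by simp [tsupport, Function.support]⟩

theorem pderiv_sub (h : IsTestFunction Ω ζ) (h' : IsTestFunction Ω ξ) (i : Fin d) (x : Eu d) :
    pderiv i (fun y => ζ y - ξ y) x = pderiv i ζ x - pderiv i ξ x := by
  simp only [pderiv]
  rw [fderiv_fun_sub (h.differentiable x) (h'.differentiable x)]
  simp

theorem pderiv_add (h : IsTestFunction Ω ζ) (h' : IsTestFunction Ω ξ) (i : Fin d) (x : Eu d) :
    pderiv i (fun y => ζ y + ξ y) x = pderiv i ζ x + pderiv i ξ x := by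
  simp only [pderiv]
  rw [fderiv_fun_add (h.differentiable x) (h'.differentiable x)]
  simp

theorem exists_bound (h : IsTestFunction Ω ζ) : ∃ C, ∀ x, |ζ x| ≤ C :=
  h.compact.exists_bound_of_continuous h.continuous

theorem exists_bound_pderiv (h : IsTestFunction Ω ζ) (i : Fin d) :
    ∃ C, ∀ x, |pderiv i ζ x| ≤ C :=
  HasCompactSupport.exists_bound_of_continuous (f := pderiv i ζ) (h.compact.fderiv_apply ℝ _)
    (h.continuous_pderiv i)

end IsTestFunction

/-! ### Mollification in an open set -/

theorem memLp_indicator (hΩ : IsOpen Ω) {f : Eu d → ℝ} (hf : MemLp f 2 (volume.restrict Ω)) :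
    MemLp (Ω.indicator f) 2 := (memLp_indicator_iff_restrict hΩ.measurableSet).2 hf

theorem locallyIntegrable_indicator (hΩ : IsOpen Ω) {f : Eu d → ℝ}
    (hf : MemLp f 2 (volume.restrict Ω)) : LocallyIntegrable (Ω.indicator f) :=
  (memLp_indicator hΩ hf).locallyIntegrable (by norm_num)

theorem contDiff_mollify_indicator (hΩ : IsOpen Ω) (n : ℕ) {f : Eu d → ℝ}
    (hf : MemLp f 2 (volume.restrict Ω)) : ContDiff ℝ ∞ (mollify n (Ω.indicator f)) :=
  contDiff_mollify n (locallyIntegrable_indicator hΩ hf)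

theorem lpTendsto_mollify (hΩ : IsOpen Ω) {f : Eu d → ℝ} (hf : MemLp f 2 (volume.restrict Ω)) :
    LpTendsto 2 (volume.restrict Ω) (fun n => mollify n (Ω.indicator f)) f := by
  have h := memLp_indicator hΩ hf
  refine ⟨fun n => (memLp_mollify n h).restrict Ω, hf, ?_⟩
  refine tendsto_of_tendsto_of_tendsto_of_le_of_le tendsto_const_nhds
    (tendsto_eLpNorm_mollify h) (fun _ => zero_le) fun n => ?_
  refine le_trans (le_of_eq (eLpNorm_congr_ae ?_)) (eLpNorm_mono_measure _ Measure.restrict_le_self)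
  filter_upwards [ae_restrict_mem hΩ.measurableSet] with x hx
  simp [hx]

theorem ae_tendsto_mollify_indicator (hΩ : IsOpen Ω) {f : Eu d → ℝ}
    (hf : MemLp f 2 (volume.restrict Ω)) :
    ∀ᵐ x ∂(volume.restrict Ω),
      Tendsto (fun n => mollify n (Ω.indicator f) x) atTop (𝓝 (f x)) := by
  filter_upwards [ae_restrict_mem hΩ.measurableSet,
    ae_restrict_of_ae (ae_tendsto_mollify (locallyIntegrable_indicator hΩ hf))] with x hx h
  simpa [hx] using h

theorem isTestFunction_kernel {n : ℕ} {x : Eu d}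
    (hx : Metric.closedBall x (1 / (n + 1)) ⊆ Ω) :
    IsTestFunction Ω fun z => kernel d n (x - z) := by
  have hsub : tsupport (fun z => kernel d n (x - z)) ⊆ Metric.closedBall x (1 / (n + 1)) := by
    refine closure_minimal (fun z hz => ?_) Metric.isClosed_closedBall
    have h1 : x - z ∈ tsupport (kernel d n) := subset_tsupport _ hz
    rw [tsupport_kernel, mem_closedBall_zero_iff] at h1
    rwa [Metric.mem_closedBall, dist_comm, dist_eq_norm]
  exact ⟨(contDiff_kernel n).comp (contDiff_const.sub contDiff_id),
    (isCompact_closedBall x _).of_isClosed_subset (isClosed_tsupport _) hsub, hsub.trans hx⟩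

/-- Near a compact subset of `Ω`, mollifications at small scale see only `Ω`. -/
theorem exists_open_closedBall_subset {K : Set (Eu d)} (hΩ : IsOpen Ω) (hK : IsCompact K)
    (hKΩ : K ⊆ Ω) : ∃ U, IsOpen U ∧ K ⊆ U ∧
      ∀ᶠ n : ℕ in atTop, ∀ x ∈ U, Metric.closedBall x (1 / ((n : ℝ) + 1)) ⊆ Ω := by
  obtain ⟨δ, hδ, h⟩ := hK.exists_cthickening_subset_open hΩ hKΩ
  refine ⟨Metric.thickening (δ / 2) K, Metric.isOpen_thickening,
    Metric.self_subset_thickening (by linarith) K, ?_⟩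
  have ht : Tendsto (fun n : ℕ => 1 / ((n : ℝ) + 1)) atTop (𝓝 0) :=
    tendsto_one_div_add_atTop_nhds_zero_nat
  filter_upwards [ht.eventually (gt_mem_nhds (show (0 : ℝ) < δ / 2 by linarith))] with n hn
  intro x hx y hy
  refine h (Metric.thickening_subset_cthickening δ K ?_)
  rw [Metric.mem_thickening_iff] at hx ⊢
  obtain ⟨z, hz, hxz⟩ := hx
  exact ⟨z, hz, by
    have := dist_triangle y x z
    rw [Metric.mem_closedBall] at hy
    linarith⟩

theorem mollify_indicator_apply (hΩ : IsOpen Ω) (n : ℕ) (f : Eu d → ℝ) (x : Eu d) :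
    mollify n (Ω.indicator f) x = ∫ y in Ω, kernel d n (x - y) * f y := by
  rw [mollify_apply, ← integral_indicator hΩ.measurableSet]
  congr 1
  ext y
  by_cases hy : y ∈ Ω <;> simp [hy]

/-- Weak identities in divergence form become classical ones after mollification. -/
theorem sum_pderiv_mollify (hΩ : IsOpen Ω) {g : Fin d → Eu d → ℝ} {h : Eu d → ℝ}
    (hg : ∀ j, MemLp (g j) 2 (volume.restrict Ω))
    (hw : ∀ ζ, IsTestFunction Ω ζ →
      ∫ x in Ω, ∑ j, g j x * pderiv j ζ x = -∫ x in Ω, h x * ζ x)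
    {n : ℕ} {x : Eu d} (hx : Metric.closedBall x (1 / (n + 1)) ⊆ Ω) :
    ∑ j, pderiv j (mollify n (Ω.indicator (g j))) x = mollify n (Ω.indicator h) x := by
  have ht := isTestFunction_kernel hx
  have e : ∀ j, pderiv j (mollify n (Ω.indicator (g j))) x
      = -∫ y in Ω, g j y * pderiv j (fun z => kernel d n (x - z)) y := fun j => by
    rw [pderiv_mollify n (locallyIntegrable_indicator hΩ (hg j)),
      ← integral_indicator hΩ.measurableSet]
    congr 2
    ext y
    by_cases hy : y ∈ Ω <;> simp [hy, mul_comm]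
  simp only [e]
  rw [Finset.sum_neg_distrib, ← integral_finsetSum, hw _ ht, neg_neg, mollify_indicator_apply hΩ]
  · congr 1
    ext y
    ring
  · exact fun j _ => (hg j).integrable_mul (ht.memLp_pderiv j)

theorem H1.pderiv_mollify (hΩ : IsOpen Ω) (u : H1 Ω) (i : Fin d) {n : ℕ} {x : Eu d}
    (hx : Metric.closedBall x (1 / (n + 1)) ⊆ Ω) :
    pderiv i (mollify n (Ω.indicator u)) x = mollify n (Ω.indicator (u.grad i)) x := by
  classical
  have h := sum_pderiv_mollify hΩ (g := fun j => if j = i then u else fun _ => 0)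
    (h := u.grad i) (fun j => by
      by_cases hj : j = i
      · simpa [hj] using u.memLp
      · simp [hj]) (fun ζ hζ => by
      have : ∀ x, ∑ j, (if j = i then (u : Eu d → ℝ) else fun _ => 0) x * pderiv j ζ x
          = u x * pderiv i ζ x := fun x => by
        rw [Finset.sum_eq_single i] <;> simp +contextual
      simp only [this]
      exact u.weak ζ hζ i) hx
  rw [Finset.sum_eq_single i] at h
  · simpa using h
  · intro j _ hj
    have : mollify n (fun _ : Eu d => (0 : ℝ)) = fun _ => 0 := by
      ext y
      simp [mollify_apply]
    simp [hj, this, pderiv]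
  · simp

end CHNS

/-! ### Calculus in `H¹(Ω)` -/

namespace CHNS

open scoped ENNReal NNReal

variable {d : ℕ} {Ω : Set (Eu d)}

theorem setIntegral_mul_pderiv {f ζ : Eu d → ℝ} (hf : ContDiff ℝ 1 f) (hζ : IsTestFunction Ω ζ)
    (i : Fin d) : ∫ x in Ω, f x * pderiv i ζ x = -∫ x in Ω, pderiv i f x * ζ x := by
  have h0 : ∫ x in Ω, pderiv i (fun y => f y * ζ y) x = 0 :=
    setIntegral_pderiv_eq_zero (hf.mul (hζ.smooth.of_le (by simp))) hζ.compact.mul_left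
      ((tsupport_mul_subset_right (f := f) (g := ζ)).trans hζ.supp) i
  have e : ∀ x, pderiv i (fun y => f y * ζ y) x = pderiv i f x * ζ x + f x * pderiv i ζ x :=
    fun x => pderiv_mul (hf.differentiable (by simp) x) (hζ.differentiable x) i
  simp only [e] at h0
  rw [integral_add] at h0
  · linarith
  · exact (((continuous_pderiv hf i).mul hζ.continuous).integrable_of_hasCompactSupport
      hζ.compact.mul_left).integrableOn
  · exact ((hf.continuous.mul (hζ.continuous_pderiv i)).integrable_of_hasCompactSupport
      (HasCompactSupport.mul_left (hζ.compact.fderiv_apply ℝ _))).integrableOn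

/-- A smooth function as an element of `H¹(Ω)`. -/
noncomputable def H1.ofSmooth (f : Eu d → ℝ) (hf : ContDiff ℝ ∞ f)
    (h : MemLp f 2 (volume.restrict Ω))
    (h' : ∀ i, MemLp (pderiv i f) 2 (volume.restrict Ω)) : H1 Ω where
  toFun := f
  grad i := pderiv i f
  memLp := h
  memLp_grad := h'
  weak _ hζ i := setIntegral_mul_pderiv (hf.of_le (by simp)) hζ i

/-- A test function as an element of `H¹(Ω)`. -/
noncomputable def IsTestFunction.toH1 {ζ : Eu d → ℝ} (h : IsTestFunction Ω ζ) : H1 Ω :=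
  H1.ofSmooth ζ h.smooth h.memLp h.memLp_pderiv

theorem IsTestFunction.isZeroTrace {ζ : Eu d → ℝ} (h : IsTestFunction Ω ζ) :
    h.toH1.IsZeroTrace :=
  ⟨fun _ => ζ, fun _ => h, by simp [IsTestFunction.toH1, H1.ofSmooth],
    by simp [IsTestFunction.toH1, H1.ofSmooth]⟩

/-- The height as a continuous linear functional. -/
noncomputable def heightCLM (d : ℕ) : Eu d →L[ℝ] ℝ :=
  ∑ i : Fin d, if (i : ℕ) = 1 then EuclideanSpace.proj i else 0

theorem heightCLM_apply (x : Eu d) : heightCLM d x = height x := by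
  simp only [heightCLM, height, _root_.sum_apply]
  refine Finset.sum_congr rfl fun i _ => ?_
  split_ifs <;> simp

theorem height_eq : (height : Eu d → ℝ) = heightCLM d := funext fun x => (heightCLM_apply x).symm

theorem pderiv_height (i : Fin d) (x : Eu d) : pderiv i height x = -gravDir i := by
  rw [height_eq, pderiv, ContinuousLinearMap.fderiv, heightCLM_apply, height, gravDir,
    Finset.sum_eq_single i]
  · split_ifs <;> simp
  · intro j _ hj
    simp [hj]
  · simp

theorem exists_bound_height (hb : Bornology.IsBounded Ω) : ∃ C, ∀ x ∈ Ω, |(height x : ℝ)| ≤ C := by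
  obtain ⟨R, hR⟩ := hb.exists_norm_le
  refine ⟨‖heightCLM d‖ * R, fun x hx => ?_⟩
  rw [← heightCLM_apply]
  exact (ContinuousLinearMap.le_opNorm _ x).trans
    (mul_le_mul_of_nonneg_left (hR x hx) (norm_nonneg (heightCLM d)))

theorem memLp_height (hΩ : IsOpen Ω) (hb : Bornology.IsBounded Ω) :
    MemLp (height : Eu d → ℝ) 2 (volume.restrict Ω) := by
  have : IsFiniteMeasure (volume.restrict Ω) :=
    ⟨by simpa using hb.measure_lt_top⟩
  obtain ⟨C, hC⟩ := exists_bound_height hb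
  have hc : Continuous (height : Eu d → ℝ) := by
    rw [height_eq]
    exact (heightCLM d).continuous
  exact MemLp.of_bound hc.aestronglyMeasurable C
    (by filter_upwards [ae_restrict_mem hΩ.measurableSet] with x hx using hC x hx)

/-- The height `y` as an element of `H¹(Ω)`; its gradient is `-ĝ`. -/
noncomputable def heightH1 (hΩ : IsOpen Ω) (hb : Bornology.IsBounded Ω) : H1 Ω :=
  H1.ofSmooth height (by rw [height_eq]; exact (heightCLM d).contDiff) (memLp_height hΩ hb)
    fun i => by
      have : IsFiniteMeasure (volume.restrict Ω) := ⟨by simpa using hb.measure_lt_top⟩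
      have h : pderiv i (height : Eu d → ℝ) = fun _ => -gravDir i := funext (pderiv_height i)
      rw [h]
      exact memLp_const _

theorem abs_sub_le_of_deriv_bound {T : ℝ → ℝ} (hT : ContDiff ℝ 1 T) {C : ℝ}
    (hC : ∀ s, |deriv T s| ≤ C) (s t : ℝ) : |T s - T t| ≤ C * |s - t| := by
  have := Convex.norm_image_sub_le_of_norm_deriv_le (f := T) (C := C) (s := Set.univ)
    (fun x _ => hT.differentiable (by simp) x) (fun x _ => hC x) convex_univ
    (Set.mem_univ t) (Set.mem_univ s)
  simpa using this

theorem memLp_comp {α : Type*} [MeasurableSpace α] {μ : Measure α} {p : ℝ≥0∞} {T : ℝ → ℝ}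
    (hT : ContDiff ℝ 1 T) (h0 : T 0 = 0) {C : ℝ} (hC : ∀ s, |deriv T s| ≤ C) {u : α → ℝ}
    (hu : MemLp u p μ) : MemLp (fun x => T (u x)) p μ :=
  hu.of_le_mul (c := C) (hT.continuous.comp_aestronglyMeasurable hu.1)
    (Eventually.of_forall fun x => by
      simpa [h0] using abs_sub_le_of_deriv_bound hT hC (u x) 0)

theorem eventually_pderiv_mollify (hΩ : IsOpen Ω) (u : H1 Ω) {ζ : Eu d → ℝ}
    (hζ : IsTestFunction Ω ζ) : ∀ᶠ n in atTop, ∀ x ∈ tsupport ζ, ∀ i,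
      pderiv i (mollify n (Ω.indicator u)) x = mollify n (Ω.indicator (u.grad i)) x := by
  obtain ⟨U, -, hKU, h⟩ := exists_open_closedBall_subset hΩ hζ.compact hζ.supp
  filter_upwards [h] with n hn x hx i
  exact u.pderiv_mollify hΩ i (hn x (hKU hx))

/-- The chain rule in `H¹(Ω)`. -/
theorem H1.weak_comp (hΩ : IsOpen Ω) (u : H1 Ω) {T : ℝ → ℝ} (hT : ContDiff ℝ 1 T)
    (h0 : T 0 = 0) {C : ℝ} (hC : ∀ s, |deriv T s| ≤ C) {ζ : Eu d → ℝ} (hζ : IsTestFunction Ω ζ)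
    (i : Fin d) :
    ∫ x in Ω, T (u x) * pderiv i ζ x = -∫ x in Ω, deriv T (u x) * u.grad i x * ζ x := by
  set U : ℕ → Eu d → ℝ := fun n => mollify n (Ω.indicator u)
  set V : ℕ → Eu d → ℝ := fun n => mollify n (Ω.indicator (u.grad i))
  have hU := lpTendsto_mollify hΩ u.memLp
  have hV := lpTendsto_mollify hΩ (u.memLp_grad i)
  have hUs : ∀ n, ContDiff ℝ ∞ (U n) := fun n => contDiff_mollify_indicator hΩ n u.memLp
  have hT' : Continuous (deriv T) := hT.continuous_deriv (by simp)
  have l1 : LpTendsto 2 (volume.restrict Ω) (fun n x => T (U n x)) fun x => T (u x) :=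
    hU.of_abs_sub_le (fun n => memLp_comp hT h0 hC (hU.memLp_seq n)) (memLp_comp hT h0 hC u.memLp)
      fun n x => abs_sub_le_of_deriv_bound hT hC _ _
  have l2 : LpTendsto 2 (volume.restrict Ω) (fun n x => deriv T (U n x) * ζ x)
      fun x => deriv T (u x) * ζ x := by
    refine LpTendsto.of_dominated (b := fun x => C * ζ x)
      (fun n => ((hT'.comp (hUs n).continuous).mul hζ.continuous).aestronglyMeasurable)
      (hζ.memLp.const_mul C) (fun n x => ?_) ?_
    · rw [abs_mul, abs_mul]
      exact mul_le_mul_of_nonneg_right ((hC _).trans (le_abs_self C)) (abs_nonneg _)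
    · filter_upwards [ae_tendsto_mollify_indicator hΩ u.memLp] with x hx
      exact ((hT'.tendsto _).comp hx).mul_const _
  have t1 := l1.tendsto_integral_mul (LpTendsto.const (hζ.memLp_pderiv i))
  have t2 := (l2.tendsto_integral_mul hV).neg
  have e : ∀ᶠ n in atTop, -∫ x in Ω, deriv T (U n x) * ζ x * V n x
      = ∫ x in Ω, T (U n x) * pderiv i ζ x := by
    filter_upwards [eventually_pderiv_mollify hΩ u hζ] with n hn
    rw [setIntegral_mul_pderiv (f := fun x => T (U n x)) (hT.comp ((hUs n).of_le (by simp))) hζ]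
    congr 2
    ext x
    by_cases hx : x ∈ tsupport ζ
    · rw [pderiv_comp (hT.differentiable (by simp) _) ((hUs n).differentiable (by simp) x)]
      change _ = deriv T (U n x) * pderiv i (mollify n (Ω.indicator u)) x * ζ x
      rw [hn x hx i]
      ring
    · simp [IsTestFunction.eq_zero_of_notMem hx]
  rw [tendsto_nhds_unique t1 (t2.congr' e)]
  congr 2
  ext x
  ring

/-- The composition of an element of `H¹(Ω)` with a function with bounded derivative. -/
noncomputable def H1.comp (hΩ : IsOpen Ω) (u : H1 Ω) (T : ℝ → ℝ) (hT : ContDiff ℝ 1 T)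
    (h0 : T 0 = 0) {C : ℝ} (hC : ∀ s, |deriv T s| ≤ C) : H1 Ω where
  toFun x := T (u x)
  grad i x := deriv T (u x) * u.grad i x
  memLp := memLp_comp hT h0 hC u.memLp
  memLp_grad i := (u.memLp_grad i).of_le_mul (c := C)
    (((hT.continuous_deriv (by simp)).comp_aestronglyMeasurable u.memLp.1).mul (u.memLp_grad i).1)
    (Eventually.of_forall fun x => by
      rw [norm_mul]
      exact mul_le_mul_of_nonneg_right (hC _) (norm_nonneg _))
  weak _ hζ i := u.weak_comp hΩ hT h0 hC hζ i

/-- The product rule in `H¹(Ω)`. -/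
theorem H1.weak_mul (hΩ : IsOpen Ω) (u v : H1 Ω) {ζ : Eu d → ℝ} (hζ : IsTestFunction Ω ζ)
    (i : Fin d) :
    ∫ x in Ω, u x * v x * pderiv i ζ x
      = -∫ x in Ω, (u x * v.grad i x + u.grad i x * v x) * ζ x := by
  set V : ℕ → Eu d → ℝ := fun n => mollify n (Ω.indicator v)
  set W : ℕ → Eu d → ℝ := fun n => mollify n (Ω.indicator (v.grad i))
  have hV := lpTendsto_mollify hΩ v.memLp
  have hW := lpTendsto_mollify hΩ (v.memLp_grad i)
  have hVs : ∀ n, ContDiff ℝ ∞ (V n) := fun n => contDiff_mollify_indicator hΩ n v.memLp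
  obtain ⟨C, hC⟩ := hζ.exists_bound
  obtain ⟨C', hC'⟩ := hζ.exists_bound_pderiv i
  have hm := hζ.continuous.aestronglyMeasurable (μ := volume.restrict Ω)
  have hm' := (hζ.continuous_pderiv i).aestronglyMeasurable (μ := volume.restrict Ω)
  have cu := LpTendsto.const u.memLp
  have cu' := LpTendsto.const (u.memLp_grad i)
  have lV := hV.mul_bounded hm' hC'
  have lW := hW.mul_bounded hm hC
  have lV' := hV.mul_bounded hm hC
  have t1 := (cu.tendsto_integral_mul lV).add (cu.tendsto_integral_mul lW)
  have t2 := (cu'.tendsto_integral_mul lV').neg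
  have e : ∀ᶠ n in atTop, -∫ x in Ω, u.grad i x * (V n x * ζ x)
      = (∫ x in Ω, u x * (V n x * pderiv i ζ x)) + ∫ x in Ω, u x * (W n x * ζ x) := by
    filter_upwards [eventually_pderiv_mollify hΩ v hζ] with n hn
    have h := u.weak _ (hζ.mul_smooth (hVs n)) i
    have h1 : ∀ x, u x * pderiv i (fun y => ζ y * V n y) x
        = u x * (V n x * pderiv i ζ x) + u x * (W n x * ζ x) := fun x => by
      rw [pderiv_mul (hζ.differentiable x) ((hVs n).differentiable (by simp) x)]
      by_cases hx : x ∈ tsupport ζ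
      · change u x * (pderiv i ζ x * V n x +
          ζ x * pderiv i (mollify n (Ω.indicator v)) x) = _
        rw [hn x hx i]
        ring
      · rw [IsTestFunction.eq_zero_of_notMem hx]
        ring
    simp only [h1] at h
    rw [← integral_add, h]
    · congr 2
      ext x
      ring
    · exact u.memLp.integrable_mul (lV.memLp_seq n)
    · exact u.memLp.integrable_mul (lW.memLp_seq n)
  have h := tendsto_nhds_unique t1 (t2.congr' e)
  have i1 : Integrable (fun x => u x * (v.grad i x * ζ x)) (volume.restrict Ω) :=
    u.memLp.integrable_mul lW.memLp
  have i2 : Integrable (fun x => u.grad i x * (v x * ζ x)) (volume.restrict Ω) :=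
    (u.memLp_grad i).integrable_mul lV'.memLp
  have e1 : ∀ x, u x * v x * pderiv i ζ x = u x * (v x * pderiv i ζ x) := fun x => by ring
  have e2 : ∀ x, (u x * v.grad i x + u.grad i x * v x) * ζ x
      = u x * (v.grad i x * ζ x) + u.grad i x * (v x * ζ x) := fun x => by ring
  simp only [e1, e2]
  rw [integral_add i1 i2]
  linarith

/-- The product of two bounded elements of `H¹(Ω)`. -/
noncomputable def H1.mul (hΩ : IsOpen Ω) (u v : H1 Ω) {C : ℝ} (hu : ∀ x, |u x| ≤ C)
    (hv : ∀ x, |v x| ≤ C) : H1 Ω where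
  toFun x := u x * v x
  grad i x := u x * v.grad i x + u.grad i x * v x
  memLp := ((LpTendsto.const u.memLp).mul_bounded v.memLp.1 hv).memLp
  memLp_grad i := by
    have h1 := ((LpTendsto.const (v.memLp_grad i)).mul_bounded u.memLp.1 hu).memLp
    have h2 := ((LpTendsto.const (u.memLp_grad i)).mul_bounded v.memLp.1 hv).memLp
    refine (h1.add h2).congr_norm ?_ (Eventually.of_forall fun x => ?_)
    · exact (u.memLp.1.mul (v.memLp_grad i).1).add ((u.memLp_grad i).1.mul v.memLp.1)
    · simp only [Pi.add_apply]
      rw [mul_comm (u x)]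
  weak _ hζ i := u.weak_mul hΩ v hζ i

/-! ### Functions with zero trace -/

theorem H1.IsZeroTrace.exists_lpTendsto {u : H1 Ω} (h : u.IsZeroTrace) :
    ∃ ζ : ℕ → Eu d → ℝ, (∀ n, IsTestFunction Ω (ζ n)) ∧
      LpTendsto 2 (volume.restrict Ω) ζ u ∧
      ∀ i, LpTendsto 2 (volume.restrict Ω) (fun n => pderiv i (ζ n)) (u.grad i) := by
  obtain ⟨ζ, h1, h2, h3⟩ := h
  refine ⟨ζ, h1, ⟨fun n => (h1 n).memLp, u.memLp, ?_⟩, fun i =>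
    ⟨fun n => (h1 n).memLp_pderiv i, u.memLp_grad i, ?_⟩⟩
  · refine h2.congr fun n => ?_
    exact eLpNorm_sub_comm _ _ _ _
  · refine (h3 i).congr fun n => ?_
    exact eLpNorm_sub_comm _ _ _ _

theorem H1.IsZeroTrace.avg {u v : H1 Ω} (hu : u.IsZeroTrace) (hv : v.IsZeroTrace) :
    (u.avg v).IsZeroTrace := by
  obtain ⟨ζ, h1, h2, h3⟩ := hu.exists_lpTendsto
  obtain ⟨ξ, k1, k2, k3⟩ := hv.exists_lpTendsto
  have : Fact ((1 : ℝ≥0∞) ≤ 2) := ⟨by norm_num⟩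
  refine ⟨fun n x => (ζ n x + ξ n x) * 2⁻¹, fun n => ((h1 n).add (k1 n)).mul_smooth contDiff_const,
    ?_, fun i => ?_⟩
  · refine ((h2.add k2).const_mul 2⁻¹).tendsto.congr fun n => ?_
    rw [← eLpNorm_neg]
    congr 1
    ext x
    simp [H1.avg]
    ring
  · refine (((h3 i).add (k3 i)).const_mul 2⁻¹).tendsto.congr fun n => ?_
    rw [← eLpNorm_neg]
    congr 1
    ext x
    rw [pderiv_mul (((h1 n).add (k1 n)).differentiable x) (differentiableAt_const _),
      (h1 n).pderiv_add (k1 n)]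
    simp [H1.avg, pderiv]
    ring

/-- Integration by parts against a function with zero trace. -/
theorem H1.IsZeroTrace.integral_mul_grad {u : H1 Ω} (hu : u.IsZeroTrace) (q : H1 Ω) (i : Fin d) :
    ∫ x in Ω, u x * q.grad i x = -∫ x in Ω, u.grad i x * q x := by
  obtain ⟨ζ, h1, h2, h3⟩ := hu.exists_lpTendsto
  have t1 := h2.tendsto_integral_mul (LpTendsto.const (q.memLp_grad i))
  have t2 := ((h3 i).tendsto_integral_mul (LpTendsto.const q.memLp)).neg
  refine tendsto_nhds_unique t1 (t2.congr fun n => ?_)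
  have := q.weak _ (h1 n) i
  simp only [mul_comm (q _), mul_comm (q.grad i _)] at this
  linarith

theorem norm_fderiv_le (f : Eu d → ℝ) (x : Eu d) : ‖fderiv ℝ f x‖ ≤ ∑ i, |pderiv i f x| := by
  refine ContinuousLinearMap.opNorm_le_bound _ (Finset.sum_nonneg fun i _ => abs_nonneg _)
    fun v => ?_
  have hv : v = ∑ i, v i • EuclideanSpace.single i (1 : ℝ) := by
    ext j
    simp [Finset.sum_apply, Pi.single_apply]
  have h : fderiv ℝ f x v = ∑ i, v i * pderiv i f x := by
    conv_lhs => rw [hv]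
    simp [pderiv]
  rw [h, Finset.sum_mul]
  refine (norm_sum_le _ _).trans (Finset.sum_le_sum fun i _ => ?_)
  rw [norm_mul, mul_comm]
  exact mul_le_mul_of_nonneg_left (PiLp.norm_apply_le v i) (abs_nonneg _)

/-- Sobolev's inequality for test functions in a bounded domain of dimension two or three. It
follows from the Gagliardo-Nirenberg-Sobolev inequality with the exponent `7 / 4`, which is below
the dimension and whose Sobolev conjugate is at least `4` in both cases. -/
theorem exists_eLpNorm_four_le (hd : d = 2 ∨ d = 3) (hb : Bornology.IsBounded Ω) :
    ∃ C : ℝ≥0∞, C ≠ ⊤ ∧ ∀ ζ, IsTestFunction Ω ζ → eLpNorm ζ 4 (volume.restrict Ω)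
      ≤ C * ∑ i, eLpNorm (pderiv i ζ) 2 (volume.restrict Ω) := by
  have hfin : IsFiniteMeasure (volume.restrict Ω) := ⟨by simpa using hb.measure_lt_top⟩
  set C₁ : ℝ≥0 := eLpNormLESNormFDerivOfLeConst ℝ (volume : Measure (Eu d)) Ω (7 / 4) 4
  set C₂ : ℝ≥0∞ :=
    (volume.restrict Ω) Set.univ ^ (1 / (7 / 4 : ℝ≥0∞).toReal - 1 / (2 : ℝ≥0∞).toReal)
  have h74 : ((7 / 4 : ℝ≥0) : ℝ≥0∞) = 7 / 4 := by
    rw [ENNReal.coe_div (by norm_num)]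
    norm_num
  have h74r : (7 / 4 : ℝ≥0∞).toReal = 7 / 4 := by
    rw [ENNReal.toReal_div]
    norm_num
  refine ⟨C₁ * C₂, ENNReal.mul_ne_top ENNReal.coe_ne_top
    (ENNReal.rpow_ne_top_of_nonneg ?_ (measure_ne_top _ _)), fun ζ hζ => ?_⟩
  · rw [h74r]
    norm_num
  have hfc : Continuous (fderiv ℝ ζ) := hζ.smooth.continuous_fderiv (by simp)
  have h1 : eLpNorm ζ (4 : ℝ≥0) volume ≤ C₁ * eLpNorm (fderiv ℝ ζ) (7 / 4 : ℝ≥0) volume := by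
    refine eLpNorm_le_eLpNorm_fderiv_of_le volume (hζ.smooth.of_le (by simp))
      ((subset_tsupport ζ).trans hζ.supp) ?_ ?_ ?_ hb
    · rw [← NNReal.coe_le_coe]
      norm_num
    · rw [← NNReal.coe_lt_coe]
      rcases hd with rfl | rfl <;> simp <;> norm_num
    · rcases hd with rfl | rfl <;> simp <;> norm_num
  have h2 : eLpNorm (fderiv ℝ ζ) (7 / 4) volume = eLpNorm (fderiv ℝ ζ) (7 / 4)
      (volume.restrict Ω) := by
    have hs : (Function.support fun x => ‖fderiv ℝ ζ x‖) ⊆ Ω := fun x hx =>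
      hζ.supp (support_fderiv_subset ℝ fun h0 => hx (by simp [h0]))
    rw [← eLpNorm_norm, ← eLpNorm_norm (μ := volume.restrict Ω)]
    exact (eLpNorm_restrict_eq_of_support_subset hs).symm
  have h3 : eLpNorm (fderiv ℝ ζ) (7 / 4) (volume.restrict Ω)
      ≤ eLpNorm (fderiv ℝ ζ) 2 (volume.restrict Ω) * C₂ := by
    refine eLpNorm_le_eLpNorm_mul_rpow_measure_univ ?_ hfc.aestronglyMeasurable
    have h : ((7 / 4 : ℝ≥0) : ℝ≥0∞) ≤ ((2 : ℝ≥0) : ℝ≥0∞) := by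
      rw [ENNReal.coe_le_coe, ← NNReal.coe_le_coe]
      norm_num
    rwa [h74, ENNReal.coe_ofNat] at h
  have h4 : eLpNorm (fderiv ℝ ζ) 2 (volume.restrict Ω)
      ≤ ∑ i, eLpNorm (pderiv i ζ) 2 (volume.restrict Ω) := by
    have a : eLpNorm (fderiv ℝ ζ) 2 (volume.restrict Ω)
        ≤ eLpNorm (∑ i, fun x => |pderiv i ζ x|) 2 (volume.restrict Ω) := by
      refine eLpNorm_mono_real fun x => ?_
      simpa using norm_fderiv_le ζ x
    refine a.trans ((eLpNorm_sum_le (fun i _ => ?_) (by norm_num)).trans (le_of_eq ?_))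
    · exact (hζ.continuous_pderiv i).abs.aestronglyMeasurable
    · exact Finset.sum_congr rfl fun i _ => eLpNorm_norm (pderiv i ζ)
  calc eLpNorm ζ 4 (volume.restrict Ω) ≤ eLpNorm ζ 4 volume :=
        eLpNorm_mono_measure _ Measure.restrict_le_self
    _ ≤ C₁ * eLpNorm (fderiv ℝ ζ) (7 / 4) volume := by
        rwa [h74, ENNReal.coe_ofNat] at h1
    _ ≤ C₁ * ((∑ i, eLpNorm (pderiv i ζ) 2 (volume.restrict Ω)) * C₂) := by
        rw [h2]
        gcongr
        exact h3.trans (by gcongr)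
    _ = _ := by ring

/-- In dimension two or three, the functions of `H¹₀(Ω)` are in `L⁴(Ω)`, and they are
approximated by test functions in `L⁴(Ω)` as well. -/
theorem H1.IsZeroTrace.exists_lpTendsto_four (hd : d = 2 ∨ d = 3) (hb : Bornology.IsBounded Ω)
    {u : H1 Ω} (hu : u.IsZeroTrace) :
    ∃ ζ : ℕ → Eu d → ℝ, (∀ n, IsTestFunction Ω (ζ n)) ∧
      LpTendsto 2 (volume.restrict Ω) ζ u ∧
      (∀ i, LpTendsto 2 (volume.restrict Ω) (fun n => pderiv i (ζ n)) (u.grad i)) ∧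
      LpTendsto 4 (volume.restrict Ω) ζ u := by
  obtain ⟨ζ, h1, h2, h3⟩ := hu.exists_lpTendsto
  obtain ⟨C, hC, hS⟩ := exists_eLpNorm_four_le hd hb
  refine ⟨ζ, h1, h2, h3, ?_⟩
  set e : ℕ → ℝ≥0∞ := fun n => C * ∑ i,
    eLpNorm (fun x => pderiv i (ζ n) x - u.grad i x) 2 (volume.restrict Ω) with he
  have he0 : Tendsto e atTop (𝓝 0) := by
    have := tendsto_finsetSum Finset.univ fun i (_ : i ∈ Finset.univ) => (h3 i).tendsto
    simpa using ENNReal.Tendsto.const_mul this (Or.inr hC)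
  have hcau : ∀ m n, eLpNorm (fun x => ζ m x - ζ n x) 4 (volume.restrict Ω) ≤ e m + e n := by
    intro m n
    refine (hS _ ((h1 m).sub (h1 n))).trans ?_
    rw [he, ← mul_add, ← Finset.sum_add_distrib]
    gcongr with i
    have a : pderiv i (fun x => ζ m x - ζ n x) = (fun x => pderiv i (ζ m) x - u.grad i x)
        - fun x => pderiv i (ζ n) x - u.grad i x := by
      ext x
      simp [(h1 m).pderiv_sub (h1 n)]
    rw [a]
    exact eLpNorm_sub_le (((h3 i).memLp_seq m).sub (u.memLp_grad i)).1
      (((h3 i).memLp_seq n).sub (u.memLp_grad i)).1 (by norm_num)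
  have htm : TendstoInMeasure (volume.restrict Ω) ζ atTop u :=
    tendstoInMeasure_of_tendsto_eLpNorm (p := 2) (by norm_num) (fun n => (h2.memLp_seq n).1)
      u.memLp.1 h2.tendsto
  obtain ⟨ns, hns, hae⟩ := htm.exists_seq_tendsto_ae
  -- Fatou's lemma along the subsequence `ns`
  have hlim : ∀ n, eLpNorm (fun x => ζ n x - u x) 4 (volume.restrict Ω) ≤ e n := by
    intro n
    have hf := Lp.eLpNorm_lim_le_liminf_eLpNorm (p := 4) (μ := volume.restrict Ω)
      (f := fun k x => ζ n x - ζ (ns k) x)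
      (fun k => ((h1 n).continuous.sub (h1 (ns k)).continuous).aestronglyMeasurable)
      (fun x => ζ n x - u x) (by filter_upwards [hae] with x hx using hx.const_sub _)
    refine hf.trans ?_
    have ht : Tendsto (fun k => e n + e (ns k)) atTop (𝓝 (e n + 0)) :=
      (he0.comp hns.tendsto_atTop).const_add (e n)
    rw [add_zero] at ht
    rw [← ht.liminf_eq]
    exact liminf_le_liminf (Eventually.of_forall fun k => hcau n (ns k))
  have hζ4 : ∀ n, MemLp (ζ n) 4 (volume.restrict Ω) := fun n =>
    ((h1 n).continuous.memLp_of_hasCompactSupport (h1 n).compact).restrict Ω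
  have hu4 : MemLp u 4 (volume.restrict Ω) := by
    obtain ⟨n, hn⟩ := (he0.eventually (gt_mem_nhds ENNReal.zero_lt_top)).exists
    have hdiff : MemLp (fun x => ζ n x - u x) 4 (volume.restrict Ω) :=
      ⟨(h1 n).continuous.aestronglyMeasurable.sub u.memLp.1, (hlim n).trans_lt hn⟩
    refine ((hζ4 n).sub hdiff).congr_norm u.memLp.1 (Eventually.of_forall fun x => ?_)
    simp
  exact ⟨hζ4, hu4, tendsto_of_tendsto_of_tendsto_of_le_of_le tendsto_const_nhds he0
    (fun _ => zero_le) hlim⟩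

theorem H1.IsZeroTrace.memLp_four (hd : d = 2 ∨ d = 3) (hb : Bornology.IsBounded Ω)
    {u : H1 Ω} (hu : u.IsZeroTrace) : MemLp u 4 (volume.restrict Ω) := by
  obtain ⟨ζ, -, -, -, h⟩ := hu.exists_lpTendsto_four hd hb
  exact h.memLp

end CHNS

/-! ### The capillary stress -/

namespace CHNS

open scoped ENNReal NNReal

variable {d : ℕ} {Ω : Set (Eu d)}

theorem pderiv_pderiv_comm {G : Eu d → ℝ} (hG : ContDiff ℝ ∞ G) (i j : Fin d) (x : Eu d) :
    pderiv i (pderiv j G) x = pderiv j (pderiv i G) x := by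
  have hd : DifferentiableAt ℝ (fderiv ℝ G) x :=
    ((hG.fderiv_right (m := ∞) (by simp)).differentiable (by simp)) x
  have e : ∀ i j : Fin d, pderiv i (pderiv j G) x
      = fderiv ℝ (fderiv ℝ G) x (EuclideanSpace.single i 1) (EuclideanSpace.single j 1) := by
    intro i j
    have := (hd.hasFDerivAt.clm_apply
      (hasFDerivAt_const (EuclideanSpace.single j (1 : ℝ)) x)).fderiv
    have h' : fderiv ℝ (pderiv j G) x = _ := this
    rw [pderiv, h']
    simp
  rw [e, e]
  have hs : IsSymmSndFDerivAt ℝ G x := hG.contDiffAt.isSymmSndFDerivAt (by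
    rw [minSmoothness_of_isRCLikeNormedField]
    exact WithTop.coe_le_coe.2 le_top)
  exact hs _ _

theorem pderiv_sum {ι : Type*} (s : Finset ι) {f : ι → Eu d → ℝ} {x : Eu d}
    (hf : ∀ k ∈ s, DifferentiableAt ℝ (f k) x) (i : Fin d) :
    pderiv i (fun y => ∑ k ∈ s, f k y) x = ∑ k ∈ s, pderiv i (f k) x := by
  simp only [pderiv]
  rw [fderiv_fun_sum hf]
  simp

theorem pderiv_add {f g : Eu d → ℝ} {x : Eu d} (hf : DifferentiableAt ℝ f x)
    (hg : DifferentiableAt ℝ g x) (i : Fin d) :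
    pderiv i (fun y => f y + g y) x = pderiv i f x + pderiv i g x := by
  simp only [pderiv]
  rw [fderiv_fun_add hf hg]
  rfl

theorem pderiv_const_mul {f : Eu d → ℝ} {x : Eu d} (hf : DifferentiableAt ℝ f x) (c : ℝ)
    (i : Fin d) : pderiv i (fun y => c * f y) x = c * pderiv i f x := by
  simp only [pderiv]
  rw [fderiv_const_mul hf]
  simp

/-- The stress-energy identity for a smooth function `G`: the divergence of the vector field
`(ζ ⋅ ∇G) ∇G - |∇G|² ζ / 2`. The terms with second derivatives of `G` cancel, except for
the Laplacian. -/
theorem sum_pderiv_stress {G : Eu d → ℝ} (hG : ContDiff ℝ ∞ G) {ζ : Fin d → Eu d → ℝ}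
    (hζ : ∀ i, Differentiable ℝ (ζ i)) (x : Eu d) :
    ∑ j, pderiv j (fun y => pderiv j G y * ∑ i, ζ i y * pderiv i G y
        + ζ j y * (-(1 / 2) * ∑ i, pderiv i G y * pderiv i G y)) x
      = (∑ j, pderiv j (pderiv j G) x) * (∑ i, ζ i x * pderiv i G x)
        + ∑ i, ∑ j, pderiv j (ζ i) x * (pderiv i G x * pderiv j G x)
        - 1 / 2 * ∑ i, ∑ j, pderiv i (ζ i) x * (pderiv j G x * pderiv j G x) := by
  have dG : ∀ i, Differentiable ℝ (pderiv i G) := fun i =>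
    (contDiff_pderiv hG i).differentiable (by simp)
  have dS : ∀ i, DifferentiableAt ℝ (fun y => ζ i y * pderiv i G y) x := fun i =>
    (hζ i x).mul (dG i x)
  have dN : ∀ i, DifferentiableAt ℝ (fun y => pderiv i G y * pderiv i G y) x := fun i =>
    (dG i x).mul (dG i x)
  have e : ∀ j, pderiv j (fun y => pderiv j G y * ∑ i, ζ i y * pderiv i G y
        + ζ j y * (-(1 / 2) * ∑ i, pderiv i G y * pderiv i G y)) x
      = pderiv j (pderiv j G) x * (∑ i, ζ i x * pderiv i G x)
        + ∑ i, pderiv j (ζ i) x * (pderiv i G x * pderiv j G x)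
        + ∑ i, ζ i x * pderiv j G x * pderiv j (pderiv i G) x
        - 1 / 2 * ∑ i, pderiv j (ζ j) x * (pderiv i G x * pderiv i G x)
        - ∑ i, ζ j x * pderiv i G x * pderiv j (pderiv i G) x := by
    intro j
    have a1 : DifferentiableAt ℝ (fun y => ∑ i, ζ i y * pderiv i G y) x :=
      DifferentiableAt.fun_sum fun i _ => dS i
    have a2 : DifferentiableAt ℝ (fun y => ∑ i, pderiv i G y * pderiv i G y) x :=
      DifferentiableAt.fun_sum fun i _ => dN i
    have a3 : DifferentiableAt ℝ (fun y => pderiv j G y * ∑ i, ζ i y * pderiv i G y) x :=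
      (dG j x).mul a1
    have a4 : DifferentiableAt ℝ
        (fun y => ζ j y * (-(1 / 2) * ∑ i, pderiv i G y * pderiv i G y)) x :=
      (hζ j x).mul (a2.const_mul _)
    rw [pderiv_add a3 a4,
      pderiv_mul (dG j x) a1, pderiv_mul (hζ j x) (a2.const_mul _),
      pderiv_const_mul a2, pderiv_sum _ (fun i _ => dS i), pderiv_sum _ (fun i _ => dN i)]
    simp only [pderiv_mul (hζ _ x) (dG _ x), pderiv_mul (dG _ x) (dG _ x), Finset.mul_sum,
      Finset.sum_add_distrib, mul_add]
    have r1 : ∀ i, pderiv j G x * (pderiv j (ζ i) x * pderiv i G x)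
        = pderiv j (ζ i) x * (pderiv i G x * pderiv j G x) := fun i => by ring
    have r2 : ∀ i, pderiv j G x * (ζ i x * pderiv j (pderiv i G) x)
        = ζ i x * pderiv j G x * pderiv j (pderiv i G) x := fun i => by ring
    have r3 : ∀ i, pderiv j (ζ j) x * (-(1 / 2) * (pderiv i G x * pderiv i G x))
        = -(1 / 2 * (pderiv j (ζ j) x * (pderiv i G x * pderiv i G x))) := fun i => by ring
    have r4 : ∀ i, ζ j x * (-(1 / 2) * (pderiv j (pderiv i G) x * pderiv i G x))
        = -(1 / 2 * (ζ j x * pderiv i G x * pderiv j (pderiv i G) x)) := fun i => by ring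
    have r5 : ∀ i, ζ j x * (-(1 / 2) * (pderiv i G x * pderiv j (pderiv i G) x))
        = -(1 / 2 * (ζ j x * pderiv i G x * pderiv j (pderiv i G) x)) := fun i => by ring
    simp only [r1, r2, r3, r4, r5, Finset.sum_neg_distrib, ← Finset.mul_sum]
    ring
  have hc : ∑ j, ∑ i, ζ i x * pderiv j G x * pderiv j (pderiv i G) x
      = ∑ j, ∑ i, ζ j x * pderiv i G x * pderiv j (pderiv i G) x := by
    rw [Finset.sum_comm]
    refine Finset.sum_congr rfl fun j _ => Finset.sum_congr rfl fun i _ => ?_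
    rw [pderiv_pderiv_comm hG]
  simp only [e, Finset.sum_add_distrib, Finset.sum_sub_distrib]
  rw [hc, ← Finset.sum_mul, ← Finset.mul_sum,
    Finset.sum_comm (f := fun j i => pderiv j (ζ i) x * (pderiv i G x * pderiv j G x))]
  ring

/-- The stress-energy identity in `H¹(Ω)`, tested with a smooth field `ζ`. Here `h` is the weak
Laplacian of `φ`, and it is enough that it is square integrable: the identity holds for the
mollifications of `φ`, whose Laplacians are the mollifications of `h`, and every term is
continuous in `L²`. -/
theorem H1.stress_identity_test (hΩ : IsOpen Ω) (φ : H1 Ω) {h : Eu d → ℝ}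
    (hh : MemLp h 2 (volume.restrict Ω))
    (hw : ∀ ζ, IsTestFunction Ω ζ →
      ∫ x in Ω, ∑ j, φ.grad j x * pderiv j ζ x = -∫ x in Ω, h x * ζ x)
    {ζ : Fin d → Eu d → ℝ} (hζ : ∀ i, IsTestFunction Ω (ζ i)) :
    (∑ i, ∫ x in Ω, h x * (φ.grad i x * ζ i x))
      + (∑ i, ∑ j, ∫ x in Ω, φ.grad j x * (φ.grad i x * pderiv j (ζ i) x))
      - 1 / 2 * ∑ i, ∑ j, ∫ x in Ω, φ.grad j x * (φ.grad j x * pderiv i (ζ i) x) = 0 := by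
  classical
  set H : ℕ → Eu d → ℝ := fun n => mollify n (Ω.indicator h)
  set g : Fin d → ℕ → Eu d → ℝ := fun i n => mollify n (Ω.indicator (φ.grad i))
  have lH : LpTendsto 2 (volume.restrict Ω) H h := lpTendsto_mollify hΩ hh
  have lg : ∀ i, LpTendsto 2 (volume.restrict Ω) (g i) (φ.grad i) := fun i =>
    lpTendsto_mollify hΩ (φ.memLp_grad i)
  have l1 : ∀ i, LpTendsto 2 (volume.restrict Ω) (fun n x => g i n x * ζ i x)
      (fun x => φ.grad i x * ζ i x) := fun i => by
    obtain ⟨C, hC⟩ := (hζ i).exists_bound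
    exact (lg i).mul_bounded (hζ i).continuous.aestronglyMeasurable hC
  have l2 : ∀ i j k, LpTendsto 2 (volume.restrict Ω) (fun n x => g i n x * pderiv j (ζ k) x)
      (fun x => φ.grad i x * pderiv j (ζ k) x) := fun i j k => by
    obtain ⟨C, hC⟩ := (hζ k).exists_bound_pderiv j
    exact (lg i).mul_bounded ((hζ k).continuous_pderiv j).aestronglyMeasurable hC
  have t1 := tendsto_finsetSum Finset.univ fun i (_ : i ∈ Finset.univ) =>
    lH.tendsto_integral_mul (l1 i)
  have t2 := tendsto_finsetSum Finset.univ fun i (_ : i ∈ Finset.univ) =>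
    tendsto_finsetSum Finset.univ fun j (_ : j ∈ Finset.univ) =>
      (lg j).tendsto_integral_mul (l2 i j i)
  have t3 := tendsto_finsetSum Finset.univ fun i (_ : i ∈ Finset.univ) =>
    tendsto_finsetSum Finset.univ fun j (_ : j ∈ Finset.univ) =>
      (lg j).tendsto_integral_mul (l2 j i i)
  refine tendsto_nhds_unique ((t1.add t2).sub (t3.const_mul (1 / 2))) ?_
  refine tendsto_const_nhds.congr' ?_
  set K : Set (Eu d) := ⋃ i, tsupport (ζ i)
  have hK : IsCompact K := isCompact_iUnion fun i => (hζ i).compact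
  have hKΩ : K ⊆ Ω := Set.iUnion_subset fun i => (hζ i).supp
  obtain ⟨U, hU, hKU, hev⟩ := exists_open_closedBall_subset hΩ hK hKΩ
  filter_upwards [hev] with n hn
  set G : Eu d → ℝ := mollify n (Ω.indicator φ)
  have hG : ContDiff ℝ ∞ G := contDiff_mollify_indicator hΩ n φ.memLp
  have hgU : ∀ x ∈ U, ∀ i, pderiv i G x = g i n x := fun x hx i => φ.pderiv_mollify hΩ i (hn x hx)
  have hLap : ∀ x ∈ U, ∑ j, pderiv j (pderiv j G) x = H n x := fun x hx => by
    change _ = mollify n (Ω.indicator h) x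
    rw [← sum_pderiv_mollify hΩ φ.memLp_grad hw (hn x hx)]
    refine Finset.sum_congr rfl fun j _ => pderiv_congr ?_ j
    filter_upwards [hU.mem_nhds hx] with y hy using hgU y hy j
  have hpt : ∀ x, ((∑ i, H n x * (g i n x * ζ i x))
      + (∑ i, ∑ j, g j n x * (g i n x * pderiv j (ζ i) x))
      - 1 / 2 * ∑ i, ∑ j, g j n x * (g j n x * pderiv i (ζ i) x))
      = ∑ j, pderiv j (fun y => pderiv j G y * ∑ i, ζ i y * pderiv i G y
        + ζ j y * (-(1 / 2) * ∑ i, pderiv i G y * pderiv i G y)) x := by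
    intro x
    rw [sum_pderiv_stress hG (fun i => (hζ i).differentiable) x]
    by_cases hx : x ∈ K
    · have hxU := hKU hx
      rw [hLap x hxU]
      simp only [hgU x hxU, Finset.mul_sum]
      congr 1
      · congr 1
        · exact Finset.sum_congr rfl fun i _ => by ring
        · exact Finset.sum_congr rfl fun i _ => Finset.sum_congr rfl fun j _ => by ring
      · exact Finset.sum_congr rfl fun i _ => Finset.sum_congr rfl fun j _ => by ring
    · have hx' : ∀ i, x ∉ tsupport (ζ i) := fun i hi => hx (Set.mem_iUnion.2 ⟨i, hi⟩)
      simp [IsTestFunction.eq_zero_of_notMem (hx' _), pderiv_eq_zero_of_notMem (hx' _)]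
  have i1 : ∀ i, Integrable (fun x => H n x * (g i n x * ζ i x)) (volume.restrict Ω) := fun i =>
    (lH.memLp_seq n).integrable_mul ((l1 i).memLp_seq n)
  have i2 : ∀ i j k l, Integrable (fun x => g i n x * (g j n x * pderiv k (ζ l) x))
      (volume.restrict Ω) := fun i j k l =>
    ((lg i).memLp_seq n).integrable_mul ((l2 j k l).memLp_seq n)
  have hX : ∀ j, ContDiff ℝ ∞ fun y => pderiv j G y * ∑ i, ζ i y * pderiv i G y
        + ζ j y * (-(1 / 2) * ∑ i, pderiv i G y * pderiv i G y) := fun j =>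
    ((contDiff_pderiv hG j).mul
      (ContDiff.sum fun i _ => (hζ i).smooth.mul (contDiff_pderiv hG i))).add
      ((hζ j).smooth.mul (contDiff_const.mul
        (ContDiff.sum fun i _ => (contDiff_pderiv hG i).mul (contDiff_pderiv hG i))))
  have hXs : ∀ j, tsupport (fun y => pderiv j G y * ∑ i, ζ i y * pderiv i G y
        + ζ j y * (-(1 / 2) * ∑ i, pderiv i G y * pderiv i G y)) ⊆ K := fun j => by
    refine closure_minimal (fun y hy => ?_) hK.isClosed
    by_contra hyK
    have hy' : ∀ i, y ∉ tsupport (ζ i) := fun i hi => hyK (Set.mem_iUnion.2 ⟨i, hi⟩)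
    exact hy (by simp [IsTestFunction.eq_zero_of_notMem (hy' _)])
  have hXc : ∀ j, HasCompactSupport (fun y => pderiv j G y * ∑ i, ζ i y * pderiv i G y
        + ζ j y * (-(1 / 2) * ∑ i, pderiv i G y * pderiv i G y)) := fun j =>
    hK.of_isClosed_subset (isClosed_tsupport _) (hXs j)
  have hz : ∫ x in Ω, ((∑ i, H n x * (g i n x * ζ i x))
      + (∑ i, ∑ j, g j n x * (g i n x * pderiv j (ζ i) x))
      - 1 / 2 * ∑ i, ∑ j, g j n x * (g j n x * pderiv i (ζ i) x)) = 0 := by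
    simp only [hpt]
    rw [integral_finsetSum]
    · exact Finset.sum_eq_zero fun j _ => setIntegral_pderiv_eq_zero ((hX j).of_le (by simp))
        (hXc j) ((hXs j).trans hKΩ) j
    · intro j _
      exact ((continuous_pderiv ((hX j).of_le (by simp)) j).integrable_of_hasCompactSupport
        ((hXc j).fderiv_apply ℝ _)).integrableOn
  have s1 : Integrable (fun x => ∑ i, H n x * (g i n x * ζ i x)) (volume.restrict Ω) :=
    integrable_finsetSum _ fun i _ => i1 i
  have s2 : Integrable (fun x => ∑ i, ∑ j, g j n x * (g i n x * pderiv j (ζ i) x))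
      (volume.restrict Ω) :=
    integrable_finsetSum _ fun i _ => integrable_finsetSum _ fun j _ => i2 j i j i
  have s3 : Integrable (fun x => ∑ i, ∑ j, g j n x * (g j n x * pderiv i (ζ i) x))
      (volume.restrict Ω) :=
    integrable_finsetSum _ fun i _ => integrable_finsetSum _ fun j _ => i2 j j i i
  have s12 : Integrable (fun x => (∑ i, H n x * (g i n x * ζ i x))
      + ∑ i, ∑ j, g j n x * (g i n x * pderiv j (ζ i) x)) (volume.restrict Ω) := s1.add s2
  rw [integral_sub s12 (s3.const_mul _), integral_add s1 s2, integral_const_mul,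
    integral_finsetSum _ (fun i _ => i1 i),
    integral_finsetSum _ (fun i _ => integrable_finsetSum _ fun j _ => i2 j i j i),
    integral_finsetSum _ (fun i _ => integrable_finsetSum _ fun j _ => i2 j j i i)] at hz
  simp only [integral_finsetSum _ (fun j _ => i2 j _ j _),
    integral_finsetSum _ (fun j _ => i2 j j _ _)] at hz
  exact hz.symm

theorem memLp_four_of_sq {α : Type*} [MeasurableSpace α] {μ : Measure α} {f : α → ℝ}
    (hm : AEStronglyMeasurable f μ) (hf : MemLp (fun x => f x * f x) 2 μ) : MemLp f 4 μ := by
  rw [← memLp_norm_rpow_iff (q := 2) hm (by norm_num) (by norm_num)]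
  have h4 : (4 : ℝ≥0∞) / 2 = 2 := by
    rw [show (4 : ℝ≥0∞) = 2 * 2 by norm_num]
    exact ENNReal.mul_div_cancel_right (by norm_num) (by norm_num)
  rw [h4]
  refine hf.congr_norm ?_ (Eventually.of_forall fun x => ?_)
  · exact (hm.norm.aemeasurable.pow_const _).aestronglyMeasurable
  · simp [sq]

/-- A field whose divergence is orthogonal to `H¹(Ω)` is divergence free almost everywhere. -/
theorem ae_div_eq_zero (hΩ : IsOpen Ω) {v : Fin d → H1 Ω}
    (hdiv : ∀ q : H1 Ω, ∫ x in Ω, q x * ∑ i, (v i).grad i x = 0) :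
    ∀ᵐ x ∂(volume.restrict Ω), ∑ i, (v i).grad i x = 0 := by
  rw [ae_restrict_iff' hΩ.measurableSet]
  have hm : MemLp (fun x => ∑ i, (v i).grad i x) 2 (volume.restrict Ω) :=
    memLp_finsetSum _ fun i _ => (v i).memLp_grad i
  refine hΩ.ae_eq_zero_of_integral_contDiff_smul_eq_zero
    (locallyIntegrableOn_of_locallyIntegrable_restrict (hm.locallyIntegrable (by norm_num)))
    fun ζ h1 h2 h3 => ?_
  have hζ : IsTestFunction Ω ζ := ⟨h1, h2, h3⟩
  have h := hdiv hζ.toH1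
  rw [← h, setIntegral_eq_integral_of_forall_compl_eq_zero]
  · rfl
  · intro x hx
    change ζ x * _ = 0
    rw [IsTestFunction.eq_zero_of_notMem (fun hx' => hx (h3 hx')), zero_mul]

/-- The work of the capillary stress against a divergence free field with zero trace. -/
theorem H1.stress_identity (hd : d = 2 ∨ d = 3) (hΩ : IsOpen Ω) (hb : Bornology.IsBounded Ω)
    (φ : H1 Ω) {h : Eu d → ℝ} (hh : MemLp h 2 (volume.restrict Ω))
    (hw : ∀ ζ, IsTestFunction Ω ζ →
      ∫ x in Ω, ∑ j, φ.grad j x * pderiv j ζ x = -∫ x in Ω, h x * ζ x)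
    (hcap : ∀ i j, MemLp (fun x => φ.grad i x * φ.grad j x) 2 (volume.restrict Ω))
    {v : Fin d → H1 Ω} (hv : ∀ i, (v i).IsZeroTrace)
    (hdiv : ∀ q : H1 Ω, ∫ x in Ω, q x * ∑ i, (v i).grad i x = 0) :
    (∫ x in Ω, h x * ∑ i, v i x * φ.grad i x)
      + ∫ x in Ω, ∑ i, ∑ j, (v i).grad j x * (φ.grad i x * φ.grad j x) = 0 := by
  choose ζ h1 _ h3 h4 using fun i => (hv i).exists_lpTendsto_four hd hb
  have hg4 : ∀ i, MemLp (φ.grad i) 4 (volume.restrict Ω) := fun i =>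
    memLp_four_of_sq (φ.memLp_grad i).1 (hcap i i)
  have l1 : ∀ i, LpTendsto 2 (volume.restrict Ω) (fun n x => ζ i n x * φ.grad i x)
      fun x => v i x * φ.grad i x := fun i => (h4 i).mul_memLp_four (hg4 i)
  have t1 := tendsto_finsetSum Finset.univ fun i (_ : i ∈ Finset.univ) =>
    (LpTendsto.const hh).tendsto_integral_mul (l1 i)
  have t2 := tendsto_finsetSum Finset.univ fun i (_ : i ∈ Finset.univ) =>
    tendsto_finsetSum Finset.univ fun j (_ : j ∈ Finset.univ) =>
      ((h3 i) j).tendsto_integral_mul (LpTendsto.const (hcap i j))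
  have t3 := tendsto_finsetSum Finset.univ fun i (_ : i ∈ Finset.univ) =>
    tendsto_finsetSum Finset.univ fun j (_ : j ∈ Finset.univ) =>
      ((h3 i) i).tendsto_integral_mul (LpTendsto.const (hcap j j))
  have key := tendsto_nhds_unique ((t1.add t2).sub (t3.const_mul (1 / 2)))
    (tendsto_const_nhds (x := (0 : ℝ)).congr fun n => by
      rw [← φ.stress_identity_test hΩ hh hw fun i => h1 i n]
      congr 1
      · congr 1
        · exact Finset.sum_congr rfl fun i _ => by congr 1; ext x; ring
        · exact Finset.sum_congr rfl fun i _ => Finset.sum_congr rfl fun j _ => by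
            congr 1; ext x; ring
      · congr 1
        exact Finset.sum_congr rfl fun i _ => Finset.sum_congr rfl fun j _ => by
            congr 1; ext x; ring)
  have i1 : ∀ i, Integrable (fun x => h x * (v i x * φ.grad i x)) (volume.restrict Ω) :=
    fun i => hh.integrable_mul (l1 i).memLp
  have i2 : ∀ i j k l, Integrable (fun x => (v i).grad j x * (φ.grad k x * φ.grad l x))
      (volume.restrict Ω) := fun i j k l => ((v i).memLp_grad j).integrable_mul (hcap k l)
  have z : ∑ i, ∑ j, ∫ x in Ω, (v i).grad i x * (φ.grad j x * φ.grad j x) = 0 := by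
    rw [Finset.sum_comm]
    refine Finset.sum_eq_zero fun j _ => ?_
    rw [← integral_finsetSum _ fun i _ => i2 i i j j]
    refine integral_eq_zero_of_ae ?_
    filter_upwards [ae_div_eq_zero hΩ hdiv] with x hx
    rw [← Finset.sum_mul, hx, zero_mul]
    rfl
  rw [z, mul_zero, sub_zero] at key
  rw [integral_finsetSum _ (fun i _ => integrable_finsetSum _ fun j _ => i2 i j i j)]
  simp only [integral_finsetSum _ (fun j _ => i2 _ j _ j), Finset.mul_sum]
  rw [integral_finsetSum _ (fun i _ => i1 i)]
  exact key

end CHNS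

/-! ### Truncation, and nonlinear test functions -/

namespace CHNS

open scoped ENNReal NNReal

/-- A smooth bounded truncation of the real line, converging to the identity as `n → ∞`. -/
noncomputable def trunc (n : ℕ) (t : ℝ) : ℝ := t / (1 + t ^ 2 / (n + 1))

/-- The derivative of `trunc n`. -/
noncomputable def truncDeriv (n : ℕ) (t : ℝ) : ℝ :=
  (1 - t ^ 2 / (n + 1)) / (1 + t ^ 2 / (n + 1)) ^ 2

theorem trunc_zero (n : ℕ) : trunc n 0 = 0 := by simp [trunc]

theorem trunc_denom_ge (n : ℕ) (t : ℝ) : 1 ≤ 1 + t ^ 2 / ((n : ℝ) + 1) := by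
  have : 0 ≤ t ^ 2 / ((n : ℝ) + 1) := by positivity
  linarith

theorem contDiff_trunc (n : ℕ) : ContDiff ℝ 1 (trunc n) :=
  contDiff_id.div (contDiff_const.add ((contDiff_id.pow 2).div_const _)) fun t => by
    have := trunc_denom_ge n t
    positivity

theorem deriv_trunc (n : ℕ) : deriv (trunc n) = truncDeriv n := by
  ext t
  have hpos := trunc_denom_ge n t
  have h := (hasDerivAt_id t).div (((hasDerivAt_pow 2 t).div_const ((n : ℝ) + 1)).const_add 1)
    (by positivity)
  have h' : deriv (trunc n) t = _ := h.deriv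
  rw [h', truncDeriv]
  simp only [id]
  congr 1
  push_cast
  ring

theorem abs_trunc_le (n : ℕ) (t : ℝ) : |trunc n t| ≤ |t| := by
  have h := trunc_denom_ge n t
  rw [trunc, abs_div, abs_of_nonneg (zero_le_one.trans h)]
  exact div_le_self (abs_nonneg t) h

theorem abs_trunc_le_bound (n : ℕ) (t : ℝ) : |trunc n t| ≤ n + 1 := by
  have h := trunc_denom_ge n t
  have hn : (1 : ℝ) ≤ (n : ℝ) + 1 := by
    have : (0 : ℝ) ≤ n := Nat.cast_nonneg n
    linarith
  rw [trunc, abs_div, abs_of_nonneg (zero_le_one.trans h), div_le_iff₀ (by linarith), mul_add,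
    mul_div_cancel₀ _ (by linarith)]
  nlinarith [sq_abs t, sq_nonneg (|t| - 1), abs_nonneg t]

theorem abs_truncDeriv_le (n : ℕ) (t : ℝ) : |truncDeriv n t| ≤ 1 := by
  have h := trunc_denom_ge n t
  have h0 : 0 ≤ t ^ 2 / ((n : ℝ) + 1) := by positivity
  rw [truncDeriv, abs_div, abs_of_nonneg (a := (_ : ℝ) ^ 2) (sq_nonneg _),
    div_le_one (by positivity)]
  have h1 : |1 - t ^ 2 / ((n : ℝ) + 1)| ≤ 1 + t ^ 2 / ((n : ℝ) + 1) :=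
    abs_le.2 ⟨by linarith, by linarith⟩
  exact h1.trans (by nlinarith)

theorem tendsto_trunc_aux (t : ℝ) :
    Tendsto (fun n : ℕ => t ^ 2 / ((n : ℝ) + 1)) atTop (𝓝 0) :=
  tendsto_const_nhds.div_atTop (tendsto_natCast_atTop_atTop.atTop_add tendsto_const_nhds)

theorem tendsto_trunc (t : ℝ) : Tendsto (fun n => trunc n t) atTop (𝓝 t) := by
  have h := (tendsto_const_nhds (x := t)).div ((tendsto_trunc_aux t).const_add 1) (by norm_num)
  simpa [trunc, Pi.div_def] using h

theorem tendsto_truncDeriv (t : ℝ) : Tendsto (fun n => truncDeriv n t) atTop (𝓝 1) := by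
  have h := ((tendsto_trunc_aux t).const_sub 1).div (((tendsto_trunc_aux t).const_add 1).pow 2)
    (by norm_num)
  simpa [truncDeriv, Pi.div_def] using h

theorem hasDerivAt_psi (t : ℝ) : HasDerivAt psi (t ^ 3 - t) t := by
  have h := (((hasDerivAt_pow 2 t).sub_const 1).pow 2).div_const 4
  refine h.congr_deriv ?_
  push_cast
  ring

theorem deriv_psi (t : ℝ) : deriv psi t = t ^ 3 - t := (hasDerivAt_psi t).deriv

theorem contDiff_psi : ContDiff ℝ ∞ psi :=
  (((contDiff_id.pow 2).sub contDiff_const).pow 2).div_const 4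

variable {d : ℕ} {Ω : Set (Eu d)}

/-- The truncation of an element of `H¹(Ω)`. -/
noncomputable def H1.truncate (hΩ : IsOpen Ω) (n : ℕ) (u : H1 Ω) : H1 Ω :=
  u.comp hΩ (trunc n) (contDiff_trunc n) (trunc_zero n) (C := 1) fun s => by
    rw [deriv_trunc]
    exact abs_truncDeriv_le n s

/-- The weak form of a transport equation `f = ∇ ⋅ F` (with no flux through the boundary), known
for test functions in `H¹(Ω)`, may be tested with the product `a b` of two elements of `H¹(Ω)`,
which need not be in `H¹(Ω)`, provided that the integrals converge: the products of truncations
are admissible, and one passes to the limit by dominated convergence. -/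
theorem H1.transport_mul (hΩ : IsOpen Ω) (a b : H1 Ω) {f : Eu d → ℝ} {F : Fin d → Eu d → ℝ}
    (hw : ∀ q : H1 Ω, (∫ x in Ω, q x * f x) + ∫ x in Ω, ∑ j, q.grad j x * F j x = 0)
    (hf : AEStronglyMeasurable f (volume.restrict Ω))
    (hab : IntegrableOn (fun x => a x * b x * f x) Ω)
    (h1 : IntegrableOn (fun x => a x * ∑ j, b.grad j x * F j x) Ω)
    (h2 : IntegrableOn (fun x => b x * ∑ j, a.grad j x * F j x) Ω)
    (hF : ∀ j, AEStronglyMeasurable (F j) (volume.restrict Ω)) :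
    (∫ x in Ω, a x * b x * f x)
      + ∫ x in Ω, (a x * (∑ j, b.grad j x * F j x) + b x * ∑ j, a.grad j x * F j x) = 0 := by
  have hTm : ∀ (n : ℕ) (u : H1 Ω), AEStronglyMeasurable (fun x => trunc n (u x))
      (volume.restrict Ω) := fun n u =>
    (contDiff_trunc n).continuous.comp_aestronglyMeasurable u.memLp.1
  have hDm : ∀ (n : ℕ) (u : H1 Ω), AEStronglyMeasurable (fun x => truncDeriv n (u x))
      (volume.restrict Ω) := fun n u => by
    have hc : Continuous (truncDeriv n) := by
      rw [← deriv_trunc]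
      exact (contDiff_trunc n).continuous_deriv (by simp)
    exact hc.comp_aestronglyMeasurable u.memLp.1
  have hSm : ∀ u : H1 Ω, AEStronglyMeasurable (fun x => ∑ j, u.grad j x * F j x)
      (volume.restrict Ω) := fun u =>
    Finset.aestronglyMeasurable_fun_sum _ fun j _ => (u.memLp_grad j).1.mul (hF j)
  have t1 : Tendsto (fun n => ∫ x in Ω, trunc n (a x) * trunc n (b x) * f x) atTop
      (𝓝 (∫ x in Ω, a x * b x * f x)) := by
    refine tendsto_integral_of_dominated_convergence (fun x => ‖a x * b x * f x‖)
      (fun n => ((hTm n a).mul (hTm n b)).mul hf) hab.norm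
      (fun n => Eventually.of_forall fun x => ?_) (Eventually.of_forall fun x => ?_)
    · simp only [norm_mul, Real.norm_eq_abs]
      exact mul_le_mul_of_nonneg_right (mul_le_mul (abs_trunc_le n _) (abs_trunc_le n _)
        (abs_nonneg _) (abs_nonneg _)) (abs_nonneg _)
    · exact ((tendsto_trunc _).mul (tendsto_trunc _)).mul_const _
  have t2 : Tendsto (fun n => ∫ x in Ω,
      (trunc n (a x) * (truncDeriv n (b x) * ∑ j, b.grad j x * F j x)
        + trunc n (b x) * (truncDeriv n (a x) * ∑ j, a.grad j x * F j x))) atTop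
      (𝓝 (∫ x in Ω, (a x * (1 * ∑ j, b.grad j x * F j x)
        + b x * (1 * ∑ j, a.grad j x * F j x)))) := by
    refine tendsto_integral_of_dominated_convergence
      (fun x => ‖a x * ∑ j, b.grad j x * F j x‖ + ‖b x * ∑ j, a.grad j x * F j x‖)
      (fun n => ((hTm n a).mul ((hDm n b).mul (hSm b))).add
        ((hTm n b).mul ((hDm n a).mul (hSm a)))) (h1.norm.add h2.norm)
      (fun n => Eventually.of_forall fun x => ?_) (Eventually.of_forall fun x => ?_)
    · have hk : ∀ y z X : ℝ, ‖trunc n y * (truncDeriv n z * X)‖ ≤ ‖y * X‖ := by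
        intro y z X
        simp only [norm_mul, Real.norm_eq_abs]
        have := mul_le_mul_of_nonneg_right (abs_truncDeriv_le n z) (abs_nonneg X)
        rw [one_mul] at this
        exact mul_le_mul (abs_trunc_le n y) this (by positivity) (abs_nonneg y)
      exact (norm_add_le _ _).trans (add_le_add (hk _ _ _) (hk _ _ _))
    · exact ((tendsto_trunc _).mul ((tendsto_truncDeriv _).mul_const _)).add
        ((tendsto_trunc _).mul ((tendsto_truncDeriv _).mul_const _))
  simp only [one_mul] at t2
  refine tendsto_nhds_unique (t1.add t2) (tendsto_const_nhds.congr fun n => ?_)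
  have h := hw ((a.truncate hΩ n).mul hΩ (b.truncate hΩ n) (fun x => abs_trunc_le_bound n (a x))
    fun x => abs_trunc_le_bound n (b x))
  rw [← h]
  congr 1
  congr 1
  ext x
  simp only [H1.mul, H1.truncate, H1.comp, deriv_trunc, Finset.mul_sum, ← Finset.sum_add_distrib]
  exact Finset.sum_congr rfl fun j _ => by ring

/-- A field without sources does no work against the gradient of `ψ(φ)`. -/
theorem H1.integral_deriv_psi_mul (hΩ : IsOpen Ω) (φ : H1 Ω) {F : Fin d → Eu d → ℝ}
    (hw : ∀ q : H1 Ω, ∫ x in Ω, ∑ j, q.grad j x * F j x = 0)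
    (hψ : MemLp (fun x => deriv psi (φ x)) 2 (volume.restrict Ω))
    (hX : MemLp (fun x => ∑ j, φ.grad j x * F j x) 2 (volume.restrict Ω)) :
    ∫ x in Ω, deriv psi (φ x) * ∑ j, φ.grad j x * F j x = 0 := by
  have hψc : Continuous (deriv psi) := contDiff_psi.continuous_deriv (by simp)
  have h3 : MemLp (fun x => φ x ^ 3) 2 (volume.restrict Ω) := by
    refine (hψ.add φ.memLp).congr_norm (φ.memLp.1.pow 3) (Eventually.of_forall fun x => ?_)
    simp [deriv_psi]
  have hdom : Integrable (fun x => (|φ x ^ 3| + |φ x|) * |∑ j, φ.grad j x * F j x|)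
      (volume.restrict Ω) := (h3.abs.add φ.memLp.abs).integrable_mul hX.abs
  have hb : ∀ n s, |deriv psi (trunc n s) * truncDeriv n s| ≤ |trunc n s| ^ 3
      + |trunc n s| := fun n s => by
    rw [abs_mul, deriv_psi]
    calc |trunc n s ^ 3 - trunc n s| * |truncDeriv n s|
        ≤ |trunc n s ^ 3 - trunc n s| * 1 :=
          mul_le_mul_of_nonneg_left (abs_truncDeriv_le n s) (abs_nonneg _)
      _ ≤ |trunc n s ^ 3| + |trunc n s| := by
          rw [mul_one]
          exact abs_sub _ _
      _ = _ := by rw [abs_pow]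
  have hTd : ∀ n s, HasDerivAt (trunc n) (truncDeriv n s) s := fun n s => by
    rw [← deriv_trunc]
    exact ((contDiff_trunc n).differentiable (by simp) s).hasDerivAt
  have hd : ∀ n s, deriv (fun s => psi (trunc n s) - 1 / 4) s
      = deriv psi (trunc n s) * truncDeriv n s := fun n s => by
    rw [deriv_psi]
    exact (((hasDerivAt_psi _).comp s (hTd n s)).sub_const (1 / 4)).deriv
  have hm : ∀ n, AEStronglyMeasurable (fun x => deriv psi (trunc n (φ x))
      * truncDeriv n (φ x)) (volume.restrict Ω) := fun n => by
    have hc : Continuous (truncDeriv n) := by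
      rw [← deriv_trunc]
      exact (contDiff_trunc n).continuous_deriv (by simp)
    exact ((hψc.comp (contDiff_trunc n).continuous).mul hc).comp_aestronglyMeasurable φ.memLp.1
  have t : Tendsto (fun n => ∫ x in Ω, deriv psi (trunc n (φ x)) * truncDeriv n (φ x)
      * ∑ j, φ.grad j x * F j x) atTop
      (𝓝 (∫ x in Ω, deriv psi (φ x) * 1 * ∑ j, φ.grad j x * F j x)) := by
    refine tendsto_integral_of_dominated_convergence _ (fun n => (hm n).mul hX.1) hdom
      (fun n => Eventually.of_forall fun x => ?_) (Eventually.of_forall fun x => ?_)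
    · rw [norm_mul, Real.norm_eq_abs, Real.norm_eq_abs]
      refine mul_le_mul_of_nonneg_right ((hb n _).trans ?_) (abs_nonneg _)
      rw [abs_pow]
      exact add_le_add (pow_le_pow_left₀ (abs_nonneg _) (abs_trunc_le n _) 3) (abs_trunc_le n _)
    · exact (((hψc.tendsto _).comp (tendsto_trunc _)).mul (tendsto_truncDeriv _)).mul_const _
  simp only [mul_one] at t
  refine tendsto_nhds_unique t (tendsto_const_nhds.congr fun n => ?_)
  have hbound : ∀ s, |deriv (fun s => psi (trunc n s) - 1 / 4) s|
      ≤ ((n : ℝ) + 1) ^ 3 + (n + 1) := fun s => by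
    rw [hd]
    refine (hb n s).trans ?_
    have := abs_trunc_le_bound n s
    gcongr
  have h := hw (φ.comp hΩ (fun s => psi (trunc n s) - 1 / 4)
    (((contDiff_psi.of_le (by simp)).comp (contDiff_trunc n)).sub contDiff_const)
    (by simp [trunc_zero, psi]) hbound)
  rw [← h]
  congr 1
  ext x
  simp only [H1.comp, hd, Finset.mul_sum]
  exact Finset.sum_congr rfl fun j _ => by ring

/-- The difference `u - v` in `H¹(Ω)`. -/
noncomputable def H1.sub (u v : H1 Ω) : H1 Ω where
  toFun x := u x - v x
  grad i x := u.grad i x - v.grad i x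
  memLp := u.memLp.sub v.memLp
  memLp_grad i := (u.memLp_grad i).sub (v.memLp_grad i)
  weak ζ hζ i := by
    have i1 : Integrable (fun x => u x * pderiv i ζ x) (volume.restrict Ω) :=
      u.memLp.integrable_mul (hζ.memLp_pderiv i)
    have i2 : Integrable (fun x => v x * pderiv i ζ x) (volume.restrict Ω) :=
      v.memLp.integrable_mul (hζ.memLp_pderiv i)
    have i3 : Integrable (fun x => u.grad i x * ζ x) (volume.restrict Ω) :=
      (u.memLp_grad i).integrable_mul hζ.memLp
    have i4 : Integrable (fun x => v.grad i x * ζ x) (volume.restrict Ω) :=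
      (v.memLp_grad i).integrable_mul hζ.memLp
    simp only [sub_mul]
    rw [integral_sub i1 i2, integral_sub i3 i4, u.weak ζ hζ i, v.weak ζ hζ i]
    ring

/-- A solenoidal field with zero trace is orthogonal to all gradients. -/
theorem integral_grad_mul_eq_zero {v : Fin d → H1 Ω} (hv : ∀ i, (v i).IsZeroTrace)
    (hdiv : ∀ q : H1 Ω, ∫ x in Ω, q x * ∑ i, (v i).grad i x = 0) (q : H1 Ω) :
    ∫ x in Ω, ∑ j, q.grad j x * v j x = 0 := by
  have i1 : ∀ j, Integrable (fun x => q.grad j x * v j x) (volume.restrict Ω) := fun j =>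
    (q.memLp_grad j).integrable_mul (v j).memLp
  have i2 : ∀ j, Integrable (fun x => q x * (v j).grad j x) (volume.restrict Ω) := fun j =>
    q.memLp.integrable_mul ((v j).memLp_grad j)
  rw [integral_finsetSum _ fun j _ => i1 j]
  have e : ∀ j, ∫ x in Ω, q.grad j x * v j x = -∫ x in Ω, q x * (v j).grad j x := fun j => by
    have := (hv j).integral_mul_grad q j
    simp only [mul_comm (q.grad j _), mul_comm (q _)]
    exact this
  simp only [e]
  rw [Finset.sum_neg_distrib, ← integral_finsetSum _ fun j _ => i2 j]
  have h := hdiv q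
  simp only [Finset.mul_sum] at h
  rw [h, neg_zero]

end CHNS

/-! ### The balance laws contained in the scheme -/

namespace CHNS

open scoped ENNReal NNReal

theorem _root_.MeasureTheory.MemLp.mul_four {α : Type*} [MeasurableSpace α] {μ : Measure α}
    {f g : α → ℝ} (hf : MemLp f 4 μ) (hg : MemLp g 4 μ) : MemLp (fun x => f x * g x) 2 μ :=
  ((LpTendsto.const hf).mul_memLp_four hg).memLp

variable {d : ℕ} {Ω : Set (Eu d)} {c : Params} {δt : ℝ} {s s' : State Ω}

theorem vMid_isZeroTrace (s s' : State Ω) (i : Fin d) : (vMid s s' i).IsZeroTrace :=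
  (s.v_zero i).avg (s'.v_zero i)

theorem solenoidal_mid (hsol : s.Solenoidal) (hsol' : s'.Solenoidal) (q : H1 Ω) :
    ∫ x in Ω, q x * ∑ i, (vMid s s' i).grad i x = 0 := by
  have hm : ∀ t : State Ω, Integrable (fun x => q x * ∑ i, (t.v i).grad i x)
      (volume.restrict Ω) := fun t =>
    q.memLp.integrable_mul (memLp_finsetSum _ fun i _ => (t.v i).memLp_grad i)
  have e : ∀ x, q x * ∑ i, (vMid s s' i).grad i x = 2⁻¹ * (q x * ∑ i, (s.v i).grad i x
      + q x * ∑ i, (s'.v i).grad i x) := fun x => by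
    simp only [vMid, H1.avg]
    rw [← Finset.sum_div, Finset.sum_add_distrib]
    ring
  simp only [e]
  rw [integral_const_mul, integral_add (hm s) (hm s'), hsol q, hsol' q]
  simp

theorem integral_grad_mul_vMid (hsol : s.Solenoidal) (hsol' : s'.Solenoidal) (q : H1 Ω) :
    ∫ x in Ω, ∑ j, q.grad j x * vMid s s' j x = 0 :=
  integral_grad_mul_eq_zero (vMid_isZeroTrace s s') (solenoidal_mid hsol hsol') q

/-- The function that is `u` in the component `i` and zero in the others. -/
noncomputable def singleH1 (i : Fin d) (u : H1 Ω) : Fin d → H1 Ω := fun k =>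
  if k = i then u else IsTestFunction.zero.toH1

theorem singleH1_isZeroTrace (i : Fin d) {u : H1 Ω} (hu : u.IsZeroTrace) (k : Fin d) :
    (singleH1 i u k).IsZeroTrace := by
  unfold singleH1
  split_ifs
  · exact hu
  · exact IsTestFunction.zero.isZeroTrace

theorem sum_singleH1_mul (i : Fin d) (u : H1 Ω) (x : Eu d) (a : Fin d → Fin d → ℝ) :
    ∑ k, ∑ j, singleH1 i u k x * a k j = u x * ∑ j, a i j := by
  rw [Finset.sum_eq_single i]
  · simp [singleH1, Finset.mul_sum]
  · intro k _ hk
    simp [singleH1, hk, IsTestFunction.toH1, H1.ofSmooth]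
  · simp

theorem integrable_convective (hdef : PairingsDefined c s s') (i : Fin d) :
    IntegrableOn (fun x => vMid s s' i x * ∑ j,
      c.rho (phiMid s s' x) * vMid s s' j x * (vMid s s' i).grad j x) Ω := by
  have h := hdef.convective _ (singleH1_isZeroTrace i (vMid_isZeroTrace s s' i))
  refine h.congr (Eventually.of_forall fun x => ?_)
  exact sum_singleH1_mul i (vMid s s' i) x
    fun k j => c.rho (phiMid s s' x) * vMid s s' j x * (vMid s s' k).grad j x

theorem integrable_fluxTransport (hdef : PairingsDefined c s s') (i : Fin d) :
    IntegrableOn (fun x => vMid s s' i x * ∑ j, flux c s s' j x * (vMid s s' i).grad j x) Ω := by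
  have h := hdef.fluxTransport _ (singleH1_isZeroTrace i (vMid_isZeroTrace s s' i))
  refine h.congr (Eventually.of_forall fun x => ?_)
  exact sum_singleH1_mul i (vMid s s' i) x fun k j => flux c s s' j x * (vMid s s' k).grad j x

theorem flux_eq (c : Params) (s s' : State Ω) (j : Fin d) (x : Eu d) :
    flux c s s' j x = -(c.alpha / c.Cn) * (muMid s s').grad j x := by
  have h1 := c.rhoP_pos.ne'
  have h2 := c.Cn_pos.ne'
  rw [flux, Params.alpha]
  congr 1
  field_simp
  ring

/-- The mass balance: multiplied by the slope of `ρ`, the Cahn-Hilliard equation says that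
`(ρ(φ^{k+1}) - ρ(φ^k)) / δt + ∇ ⋅ (ρ̃ ṽ + J̃ / Pe) = 0` in the weak sense, because `ṽ` is
solenoidal. -/
theorem mass_balance (hsol : s.Solenoidal) (hstep : IsStep c δt s s') (q : H1 Ω) :
    (∫ x in Ω, q x * (c.alpha * ((s'.phi x - s.phi x) / δt)))
      + ∫ x in Ω, ∑ j, q.grad j x *
        -(c.rho (phiMid s s' x) * vMid s s' j x + 1 / c.Pe * flux c s s' j x) = 0 := by
  have hCH := hstep.cahnHilliard q
  have hS := integral_grad_mul_vMid hsol hstep.solenoidal q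
  have e1 : ∀ x, q x * (c.alpha * ((s'.phi x - s.phi x) / δt))
      = c.alpha * (q x * ((s'.phi x - s.phi x) / δt)) := fun x => by ring
  set β := (c.rhoP + c.rhoM) / (2 * c.rhoP) with hβ
  have e2 : ∀ x, ∑ j, q.grad j x *
        -(c.rho (phiMid s s' x) * vMid s s' j x + 1 / c.Pe * flux c s s' j x)
      = -c.alpha * (∑ j, q.grad j x * (vMid s s' j x * phiMid s s' x))
        + -β * (∑ j, q.grad j x * vMid s s' j x)
        + c.alpha * (1 / (c.Pe * c.Cn)) * ∑ j, q.grad j x * (muMid s s').grad j x := fun x => by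
    simp only [Finset.mul_sum, ← Finset.sum_add_distrib]
    refine Finset.sum_congr rfl fun j _ => ?_
    have h1 := c.Pe_pos.ne'
    have h2 := c.Cn_pos.ne'
    rw [flux_eq, Params.rho, ← hβ]
    field_simp
    ring
  simp only [e1, e2]
  have i1 : Integrable (fun x => ∑ j, q.grad j x * (vMid s s' j x * phiMid s s' x))
      (volume.restrict Ω) := integrable_finsetSum _ fun j _ =>
    (q.memLp_grad j).integrable_mul (hstep.defined.advective j)
  have i2 : Integrable (fun x => ∑ j, q.grad j x * vMid s s' j x) (volume.restrict Ω) :=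
    integrable_finsetSum _ fun j _ => (q.memLp_grad j).integrable_mul (vMid s s' j).memLp
  have i3 : Integrable (fun x => ∑ j, q.grad j x * (muMid s s').grad j x) (volume.restrict Ω) :=
    integrable_finsetSum _ fun j _ =>
      (q.memLp_grad j).integrable_mul ((muMid s s').memLp_grad j)
  have i12 : Integrable (fun x => -c.alpha * (∑ j, q.grad j x * (vMid s s' j x * phiMid s s' x))
        + -β * (∑ j, q.grad j x * vMid s s' j x)) (volume.restrict Ω) :=
    (i1.const_mul _).add (i2.const_mul _)
  rw [integral_add i12 (i3.const_mul _), integral_add (i1.const_mul _) (i2.const_mul _),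
    integral_const_mul, integral_const_mul, integral_const_mul, integral_const_mul, hS]
  linear_combination c.alpha * hCH

/-- The mass balance tested with `|ṽ|² / 2`: the change of density accounts for the convective
term and for the transport of momentum by the flux `J̃`. -/
theorem kinetic_transport (hd : d = 2 ∨ d = 3) (hΩ : IsOpen Ω) (hb : Bornology.IsBounded Ω)
    (hsol : s.Solenoidal) (hstep : IsStep c δt s s') :
    1 / 2 * (c.alpha / δt) * (∫ x in Ω, (s'.phi x - s.phi x) * ∑ i, vMid s s' i x ^ 2)
      = (∫ x in Ω, ∑ i, ∑ j, vMid s s' i x *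
          (c.rho (phiMid s s' x) * vMid s s' j x * (vMid s s' i).grad j x))
        + 1 / c.Pe * ∫ x in Ω, ∑ i, ∑ j, vMid s s' i x *
          (flux c s s' j x * (vMid s s' i).grad j x) := by
  have hv4 : ∀ i, MemLp (vMid s s' i) 4 (volume.restrict Ω) := fun i =>
    (vMid_isZeroTrace s s' i).memLp_four hd hb
  have hδ : MemLp (fun x => s'.phi x - s.phi x) 2 (volume.restrict Ω) :=
    s'.phi.memLp.sub s.phi.memLp
  have hf : MemLp (fun x => c.alpha * ((s'.phi x - s.phi x) / δt)) 2 (volume.restrict Ω) := by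
    simpa only [div_eq_inv_mul] using (hδ.const_mul δt⁻¹).const_mul c.alpha
  have iC := integrable_convective hstep.defined
  have iJ := integrable_fluxTransport hstep.defined
  have iφ : ∀ i, Integrable (fun x => (s'.phi x - s.phi x) * vMid s s' i x ^ 2)
      (volume.restrict Ω) := fun i => by
    simp only [sq]
    exact hδ.integrable_mul ((hv4 i).mul_four (hv4 i))
  have key : ∀ i, 1 / 2 * (c.alpha / δt) * (∫ x in Ω, (s'.phi x - s.phi x) * vMid s s' i x ^ 2)
      = (∫ x in Ω, vMid s s' i x * ∑ j,
          c.rho (phiMid s s' x) * vMid s s' j x * (vMid s s' i).grad j x)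
        + 1 / c.Pe * ∫ x in Ω, vMid s s' i x * ∑ j,
          flux c s s' j x * (vMid s s' i).grad j x := by
    intro i
    set F : Fin d → Eu d → ℝ := fun j x =>
      -(c.rho (phiMid s s' x) * vMid s s' j x + 1 / c.Pe * flux c s s' j x) with hF
    have hρm : AEStronglyMeasurable (fun x => c.rho (phiMid s s' x)) (volume.restrict Ω) :=
      ((phiMid s s').memLp.1.const_mul _).add aestronglyMeasurable_const
    have hFm : ∀ j, AEStronglyMeasurable (F j) (volume.restrict Ω) := fun j =>
      ((hρm.mul (vMid s s' j).memLp.1).add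
        ((((muMid s s').memLp_grad j).1.const_mul _).const_mul _)).neg
    have e0 : ∀ x, vMid s s' i x * ∑ j, (vMid s s' i).grad j x * F j x
        = -(vMid s s' i x * ∑ j, c.rho (phiMid s s' x) * vMid s s' j x * (vMid s s' i).grad j x)
          + -(1 / c.Pe) * (vMid s s' i x * ∑ j, flux c s s' j x * (vMid s s' i).grad j x) := by
      intro x
      simp only [hF, Finset.mul_sum, ← Finset.sum_neg_distrib, ← Finset.sum_add_distrib]
      exact Finset.sum_congr rfl fun j _ => by ring
    have i1 : IntegrableOn (fun x => vMid s s' i x * ∑ j, (vMid s s' i).grad j x * F j x) Ω := by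
      simp only [e0]
      exact (iC i).neg.add ((iJ i).const_mul _)
    have e3 : ∀ x, vMid s s' i x * vMid s s' i x * (c.alpha * ((s'.phi x - s.phi x) / δt))
        = c.alpha / δt * ((s'.phi x - s.phi x) * vMid s s' i x ^ 2) := fun x => by ring
    have h := H1.transport_mul hΩ (vMid s s' i) (vMid s s' i)
      (mass_balance hsol hstep) hf.1 (by simp only [e3]; exact (iφ i).const_mul _) i1 i1 hFm
    simp only [← two_mul] at h
    have e4 : ∫ x in Ω, vMid s s' i x * ∑ j, (vMid s s' i).grad j x * F j x
        = -(∫ x in Ω, vMid s s' i x * ∑ j,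
            c.rho (phiMid s s' x) * vMid s s' j x * (vMid s s' i).grad j x)
          + -(1 / c.Pe) * ∫ x in Ω, vMid s s' i x * ∑ j,
            flux c s s' j x * (vMid s s' i).grad j x := by
      simp only [e0]
      rw [integral_add (iC i).fun_neg ((iJ i).const_mul _), integral_neg, integral_const_mul]
    change _ + ∫ x in Ω, 2 * (vMid s s' i x * ∑ j, (vMid s s' i).grad j x * F j x) = 0 at h
    rw [integral_const_mul, e4] at h
    simp only [e3] at h
    rw [integral_const_mul] at h
    linear_combination 1 / 2 * h
  have e5 : ∀ x, (s'.phi x - s.phi x) * ∑ i, vMid s s' i x ^ 2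
      = ∑ i, (s'.phi x - s.phi x) * vMid s s' i x ^ 2 := fun x => Finset.mul_sum _ _ _
  simp only [← Finset.mul_sum]
  simp only [e5]
  rw [integral_finsetSum _ fun i _ => iφ i, integral_finsetSum _ fun i _ => iC i,
    integral_finsetSum _ fun i _ => iJ i, Finset.mul_sum, Finset.mul_sum, ← Finset.sum_add_distrib]
  exact Finset.sum_congr rfl fun i _ => key i

/-- The exchange between kinetic and free energy: the advection of the phase field, tested with
the chemical potential, balances the work of the capillary stress. -/
theorem capillary_exchange (hd : d = 2 ∨ d = 3) (hΩ : IsOpen Ω) (hb : Bornology.IsBounded Ω)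
    (hsol : s.Solenoidal) (hstep : IsStep c δt s s') :
    (∫ x in Ω, ∑ i, (muMid s s').grad i x * (vMid s s' i x * phiMid s s' x))
      = -c.Cn ^ 2 * ∫ x in Ω, ∑ i, ∑ j, (vMid s s' i).grad j x *
        ((phiMid s s').grad i x * (phiMid s s').grad j x) := by
  set φ := phiMid s s' with hφ
  set m := muMid s s' with hm
  set v := vMid s s' with hv
  have hCn := c.Cn_pos.ne'
  have hv0 : ∀ i, (v i).IsZeroTrace := vMid_isZeroTrace s s'
  have hdiv := solenoidal_mid hsol hstep.solenoidal
  have hS := integral_grad_mul_vMid hsol hstep.solenoidal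
  have hcap := hstep.defined.capillary
  have hψ : MemLp (fun x => deriv psi (φ x)) 2 (volume.restrict Ω) := hstep.defined.potential
  have hX : MemLp (fun x => ∑ j, φ.grad j x * v j x) 2 (volume.restrict Ω) :=
    memLp_finsetSum _ fun j _ =>
      (memLp_four_of_sq (φ.memLp_grad j).1 (hcap j j)).mul_four ((hv0 j).memLp_four hd hb)
  -- `h` is the weak Laplacian of `φ̃`
  set h : Eu d → ℝ := fun x => (c.Cn ^ 2)⁻¹ * (deriv psi (φ x) - m x) with hh
  have hhm : MemLp h 2 (volume.restrict Ω) := (hψ.sub m.memLp).const_mul _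
  have hw : ∀ ζ, IsTestFunction Ω ζ →
      ∫ x in Ω, ∑ j, φ.grad j x * pderiv j ζ x = -∫ x in Ω, h x * ζ x := by
    intro ζ hζ
    have hc := hstep.chemicalPotential hζ.toH1
    change -(∫ x in Ω, ζ x * m x) + (∫ x in Ω, ζ x * deriv psi (φ x))
      + c.Cn ^ 2 * (∫ x in Ω, ∑ i, pderiv i ζ x * φ.grad i x) = 0 at hc
    have j1 : Integrable (fun x => ζ x * m x) (volume.restrict Ω) :=
      hζ.memLp.integrable_mul m.memLp
    have j2 : Integrable (fun x => ζ x * deriv psi (φ x)) (volume.restrict Ω) :=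
      hζ.memLp.integrable_mul hψ
    have e : ∀ x, h x * ζ x = (c.Cn ^ 2)⁻¹ * (ζ x * deriv psi (φ x) - ζ x * m x) := fun x => by
      simp only [hh]
      ring
    simp only [e, mul_comm (φ.grad _ _)]
    rw [integral_const_mul, integral_sub j2 j1]
    field_simp
    linear_combination hc
  have hstress := φ.stress_identity hd hΩ hb hhm hw hcap hv0 hdiv
  have hpot := φ.integral_deriv_psi_mul hΩ hS hψ hX
  have i1 : Integrable (fun x => m x * ∑ j, φ.grad j x * v j x) (volume.restrict Ω) :=
    m.memLp.integrable_mul hX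
  have i0 : Integrable (fun x => deriv psi (φ x) * ∑ j, φ.grad j x * v j x) (volume.restrict Ω) :=
    hψ.integrable_mul hX
  have e2 : ∀ x, φ x * ∑ j, m.grad j x * v j x = ∑ i, m.grad i x * (v i x * φ x) := fun x => by
    rw [Finset.mul_sum]
    exact Finset.sum_congr rfl fun j _ => by ring
  have i2 : Integrable (fun x => φ x * ∑ j, m.grad j x * v j x) (volume.restrict Ω) := by
    simp only [e2]
    exact integrable_finsetSum _ fun j _ =>
      (m.memLp_grad j).integrable_mul (hstep.defined.advective j)
  have hL := H1.transport_mul hΩ m φ (f := fun _ => 0) (F := fun j => v j)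
    (fun q => by simpa using hS q) aestronglyMeasurable_const (by simp) i1 i2
    fun j => (v j).memLp.1
  rw [integral_add i1 i2] at hL
  simp only [mul_zero, integral_zero, zero_add, e2] at hL
  have e3 : ∀ x, h x * ∑ i, v i x * φ.grad i x = (c.Cn ^ 2)⁻¹ *
      (deriv psi (φ x) * (∑ j, φ.grad j x * v j x) - m x * ∑ j, φ.grad j x * v j x) := fun x => by
    simp only [hh, mul_comm (v _ _)]
    ring
  simp only [e3] at hstress
  rw [integral_const_mul, integral_sub i0 i1, hpot] at hstress
  have h4 : (c.Cn ^ 2)⁻¹ * c.Cn ^ 2 = 1 := inv_mul_cancel₀ (pow_ne_zero 2 hCn)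
  linear_combination hL + c.Cn ^ 2 * hstress
    + (∫ x in Ω, m x * ∑ j, φ.grad j x * v j x) * h4

/-- The exchange between kinetic and gravitational energy: the mass balance tested with the
height. -/
theorem gravity_exchange (hΩ : IsOpen Ω) (hb : Bornology.IsBounded Ω)
    (hsol : s.Solenoidal) (hstep : IsStep c δt s s')
    (hgrav : ∫ x in Ω, ∑ i, flux c s s' i x * gravDir i = 0) :
    c.alpha / δt * (∫ x in Ω, (s'.phi x - s.phi x) * height x)
      + ∫ x in Ω, ∑ i, vMid s s' i x * (c.rho (phiMid s s' x) * gravDir i) = 0 := by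
  have h := mass_balance hsol hstep (heightH1 hΩ hb)
  have e1 : ∀ x, heightH1 hΩ hb x * (c.alpha * ((s'.phi x - s.phi x) / δt))
      = c.alpha / δt * ((s'.phi x - s.phi x) * height x) := fun x => by
    simp only [heightH1, H1.ofSmooth]
    ring
  have e2 : ∀ x, ∑ j, (heightH1 hΩ hb).grad j x *
        -(c.rho (phiMid s s' x) * vMid s s' j x + 1 / c.Pe * flux c s s' j x)
      = (∑ i, vMid s s' i x * (c.rho (phiMid s s' x) * gravDir i))
        + 1 / c.Pe * ∑ i, flux c s s' i x * gravDir i := fun x => by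
    simp only [heightH1, H1.ofSmooth, pderiv_height, Finset.mul_sum, ← Finset.sum_add_distrib]
    exact Finset.sum_congr rfl fun j _ => by ring
  have hfin : IsFiniteMeasure (volume.restrict Ω) := ⟨by simpa using hb.measure_lt_top⟩
  have hρ : MemLp (fun x => c.rho (phiMid s s' x)) 2 (volume.restrict Ω) :=
    ((phiMid s s').memLp.const_mul _).add (memLp_const _)
  have i1 : Integrable (fun x => ∑ i, vMid s s' i x * (c.rho (phiMid s s' x) * gravDir i))
      (volume.restrict Ω) := integrable_finsetSum _ fun i _ =>
    (vMid s s' i).memLp.integrable_mul (hρ.mul_const _)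
  have i2 : Integrable (fun x => ∑ i, flux c s s' i x * gravDir i) (volume.restrict Ω) :=
    integrable_finsetSum _ fun i _ =>
      ((((muMid s s').memLp_grad i).integrable (by norm_num)).const_mul _).mul_const _
  simp only [e1, e2] at h
  rw [integral_const_mul, integral_add i1 (i2.const_mul _), integral_const_mul, hgrav] at h
  linear_combination h

end CHNS

/-! ### The energy law and energy stability -/

namespace CHNS

theorem iteratedDeriv_three_psi (t : ℝ) : iteratedDeriv 3 psi t = 6 * t := by
  have h1 : deriv psi = fun t => t ^ 3 - t := funext deriv_psi
  have h2 : deriv (fun t : ℝ => t ^ 3 - t) = fun t => 3 * t ^ 2 - 1 := by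
    ext t
    have h := ((hasDerivAt_pow 3 t).sub (hasDerivAt_id t)).deriv
    exact h.trans (by norm_num)
  have h3 : HasDerivAt (fun t : ℝ => 3 * t ^ 2 - 1) (6 * t) t := by
    refine (((hasDerivAt_pow 2 t).const_mul 3).sub_const 1).congr_deriv ?_
    push_cast
    ring
  rw [iteratedDeriv_succ, iteratedDeriv_succ, iteratedDeriv_one, h1, h2, h3.deriv]

/-- For the quartic `ψ`, the midpoint is an intermediate point in the Taylor expansion. -/
theorem psi_sub_psi (a b : ℝ) :
    psi b - psi a = deriv psi ((a + b) / 2) * (b - a)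
      + 1 / 24 * (iteratedDeriv 3 psi ((a + b) / 2) * (b - a) ^ 3) := by
  rw [iteratedDeriv_three_psi, deriv_psi, psi, psi]
  ring

variable {d : ℕ} {Ω : Set (Eu d)} {c : Params} {δt : ℝ} {s s' : State Ω}

theorem memLp_rho (hb : Bornology.IsBounded Ω) (u : H1 Ω) :
    MemLp (fun x => c.rho (u x)) 2 (volume.restrict Ω) := by
  have hfin : IsFiniteMeasure (volume.restrict Ω) := ⟨by simpa using hb.measure_lt_top⟩
  exact (u.memLp.const_mul _).add (memLp_const _)

theorem memLp_sum_sq {α : Type*} [MeasurableSpace α] {μ : Measure α} {f : Fin d → α → ℝ}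
    (hf : ∀ i, MemLp (f i) 4 μ) : MemLp (fun x => ∑ i, f i x ^ 2) 2 μ := by
  simp only [sq]
  exact memLp_finsetSum _ fun i _ => (hf i).mul_four (hf i)

theorem energyDefined (hd : d = 2 ∨ d = 3) (hΩ : IsOpen Ω) (hb : Bornology.IsBounded Ω)
    (hfin : IntegrableOn (fun x => psi (s.phi x)) Ω) : EnergyDefined c s := by
  refine ⟨(memLp_rho hb s.phi).integrable_mul
    (memLp_sum_sq fun i => (s.v_zero i).memLp_four hd hb), hfin.add ?_,
    (memLp_rho hb s.phi).integrable_mul (memLp_height hΩ hb)⟩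
  exact (integrable_finsetSum _ fun i _ => (s.phi.memLp_grad i).integrable_sq).const_mul _

theorem integrable_densityTerm (hd : d = 2 ∨ d = 3) (hb : Bornology.IsBounded Ω) :
    IntegrableOn (densityTerm c s s') Ω :=
  ((memLp_rho hb s'.phi).sub (memLp_rho hb s.phi)).integrable_mul
    (memLp_sum_sq fun i => ((s'.v_zero i).memLp_four hd hb).sub ((s.v_zero i).memLp_four hd hb))

/-- The pointwise midpoint identity `ρ'|v'|² - ρ|v|² = 2 ρ̃ ṽ ⋅ δv + δρ |ṽ|² + δρ |δv|² / 4`,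
integrated. -/
theorem kinetic_sub (hd : d = 2 ∨ d = 3) (hb : Bornology.IsBounded Ω) (hδt : 0 < δt) :
    (∫ x in Ω, c.rho (s'.phi x) * ∑ i, s'.v i x ^ 2) - ∫ x in Ω, c.rho (s.phi x) * ∑ i, s.v i x ^ 2
      = 2 * δt * (∫ x in Ω, ∑ i, vMid s s' i x *
          (c.rho (phiMid s s' x) * ((s'.v i x - s.v i x) / δt)))
        + c.alpha * (∫ x in Ω, (s'.phi x - s.phi x) * ∑ i, vMid s s' i x ^ 2)
        + 1 / 4 * ∫ x in Ω, densityTerm c s s' x := by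
  have h4 : ∀ (t : State Ω) i, MemLp (t.v i) 4 (volume.restrict Ω) := fun t i =>
    (t.v_zero i).memLp_four hd hb
  have hm4 : ∀ i, MemLp (vMid s s' i) 4 (volume.restrict Ω) := fun i =>
    (vMid_isZeroTrace s s' i).memLp_four hd hb
  have i0 : ∀ t : State Ω, Integrable (fun x => c.rho (t.phi x) * ∑ i, t.v i x ^ 2)
      (volume.restrict Ω) := fun t =>
    (memLp_rho hb t.phi).integrable_mul (memLp_sum_sq (h4 t))
  have e1 : ∀ x, ∑ i, vMid s s' i x * (c.rho (phiMid s s' x) * ((s'.v i x - s.v i x) / δt))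
      = δt⁻¹ * (c.rho (phiMid s s' x) * ∑ i, vMid s s' i x * (s'.v i x - s.v i x)) := fun x => by
    simp only [Finset.mul_sum]
    exact Finset.sum_congr rfl fun i _ => by ring
  have i1 : Integrable (fun x => c.rho (phiMid s s' x) *
      ∑ i, vMid s s' i x * (s'.v i x - s.v i x)) (volume.restrict Ω) :=
    (memLp_rho hb _).integrable_mul (memLp_finsetSum _ fun i _ =>
      (hm4 i).mul_four ((h4 s' i).sub (h4 s i)))
  have i2 : Integrable (fun x => (s'.phi x - s.phi x) * ∑ i, vMid s s' i x ^ 2)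
      (volume.restrict Ω) := (s'.phi.memLp.sub s.phi.memLp).integrable_mul (memLp_sum_sq hm4)
  have i3 : Integrable (densityTerm c s s') (volume.restrict Ω) := integrable_densityTerm hd hb
  have e2 : ∀ x, c.rho (s'.phi x) * (∑ i, s'.v i x ^ 2) - c.rho (s.phi x) * ∑ i, s.v i x ^ 2
      = 2 * (c.rho (phiMid s s' x) * ∑ i, vMid s s' i x * (s'.v i x - s.v i x))
        + c.alpha * ((s'.phi x - s.phi x) * ∑ i, vMid s s' i x ^ 2)
        + 1 / 4 * densityTerm c s s' x := fun x => by
    simp only [densityTerm, Finset.mul_sum, ← Finset.sum_sub_distrib, ← Finset.sum_add_distrib]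
    refine Finset.sum_congr rfl fun i _ => ?_
    simp only [vMid, phiMid, H1.avg, Params.rho]
    ring
  have i12 : Integrable (fun x => 2 * (c.rho (phiMid s s' x) *
      ∑ i, vMid s s' i x * (s'.v i x - s.v i x))
        + c.alpha * ((s'.phi x - s.phi x) * ∑ i, vMid s s' i x ^ 2)) (volume.restrict Ω) :=
    (i1.const_mul _).add (i2.const_mul _)
  rw [← integral_sub (i0 s') (i0 s)]
  simp only [e1, e2]
  rw [integral_add i12 (i3.const_mul _), integral_add (i1.const_mul _) (i2.const_mul _),
    integral_const_mul, integral_const_mul, integral_const_mul, integral_const_mul]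
  field_simp

theorem cubicTerm_eq (x : Eu d) :
    cubicTerm s s' (fun x => (s.phi x + s'.phi x) / 2) x
      = 24 * (psi (s'.phi x) - psi (s.phi x)
        - (s'.phi x - s.phi x) * deriv psi (phiMid s s' x)) := by
  rw [psi_sub_psi (s.phi x) (s'.phi x), cubicTerm, phiMid, H1.avg]
  ring

theorem integrable_cubicTerm (hdef : PairingsDefined c s s')
    (hfin : IntegrableOn (fun x => psi (s.phi x)) Ω)
    (hfin' : IntegrableOn (fun x => psi (s'.phi x)) Ω) :
    IntegrableOn (cubicTerm s s' fun x => (s.phi x + s'.phi x) / 2) Ω := by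
  have i1 : Integrable (fun x => (s'.phi x - s.phi x) * deriv psi (phiMid s s' x))
      (volume.restrict Ω) := (s'.phi.memLp.sub s.phi.memLp).integrable_mul hdef.potential
  rw [funext cubicTerm_eq]
  exact ((hfin'.sub hfin).sub i1).const_mul 24

/-- The increment of the free energy is the pairing of the chemical potential with the increment
of the phase field, up to the remainder in the Taylor expansion of `ψ`. -/
theorem free_energy_sub (hstep : IsStep c δt s s')
    (hfin : IntegrableOn (fun x => psi (s.phi x)) Ω)
    (hfin' : IntegrableOn (fun x => psi (s'.phi x)) Ω) :
    (∫ x in Ω, (psi (s'.phi x) + c.Cn ^ 2 / 2 * ∑ i, s'.phi.grad i x ^ 2))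
        - (∫ x in Ω, (psi (s.phi x) + c.Cn ^ 2 / 2 * ∑ i, s.phi.grad i x ^ 2))
      = (∫ x in Ω, (s'.phi x - s.phi x) * muMid s s' x)
        + 1 / 24 * ∫ x in Ω, cubicTerm s s' (fun x => (s.phi x + s'.phi x) / 2) x := by
  have h := hstep.chemicalPotential (s'.phi.sub s.phi)
  change -(∫ x in Ω, (s'.phi x - s.phi x) * muMid s s' x)
    + (∫ x in Ω, (s'.phi x - s.phi x) * deriv psi (phiMid s s' x))
    + c.Cn ^ 2 * (∫ x in Ω, ∑ i, (s'.phi.grad i x - s.phi.grad i x) * (phiMid s s').grad i x) = 0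
    at h
  have hδ : MemLp (fun x => s'.phi x - s.phi x) 2 (volume.restrict Ω) :=
    s'.phi.memLp.sub s.phi.memLp
  have g : ∀ t : State Ω, Integrable (fun x => psi (t.phi x)) (volume.restrict Ω) →
      Integrable (fun x => psi (t.phi x) + c.Cn ^ 2 / 2 * ∑ i, t.phi.grad i x ^ 2)
        (volume.restrict Ω) := fun t ht =>
    ht.add ((integrable_finsetSum _ fun i _ => (t.phi.memLp_grad i).integrable_sq).const_mul _)
  have i1 : Integrable (fun x => (s'.phi x - s.phi x) * deriv psi (phiMid s s' x))
      (volume.restrict Ω) := hδ.integrable_mul hstep.defined.potential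
  have i2 : Integrable (fun x => ∑ i, (s'.phi.grad i x - s.phi.grad i x) *
      (phiMid s s').grad i x) (volume.restrict Ω) := integrable_finsetSum _ fun i _ =>
    ((s'.phi.memLp_grad i).sub (s.phi.memLp_grad i)).integrable_mul ((phiMid s s').memLp_grad i)
  have i3 : Integrable (cubicTerm s s' fun x => (s.phi x + s'.phi x) / 2) (volume.restrict Ω) :=
    integrable_cubicTerm hstep.defined hfin hfin'
  have e : ∀ x, psi (s'.phi x) + c.Cn ^ 2 / 2 * (∑ i, s'.phi.grad i x ^ 2)
      - (psi (s.phi x) + c.Cn ^ 2 / 2 * ∑ i, s.phi.grad i x ^ 2)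
      = (s'.phi x - s.phi x) * deriv psi (phiMid s s' x)
        + c.Cn ^ 2 * (∑ i, (s'.phi.grad i x - s.phi.grad i x) * (phiMid s s').grad i x)
        + 1 / 24 * cubicTerm s s' (fun x => (s.phi x + s'.phi x) / 2) x := fun x => by
    have e1 : c.Cn ^ 2 / 2 * (∑ i, s'.phi.grad i x ^ 2) - c.Cn ^ 2 / 2 * (∑ i, s.phi.grad i x ^ 2)
        = c.Cn ^ 2 * ∑ i, (s'.phi.grad i x - s.phi.grad i x) * (phiMid s s').grad i x := by
      simp only [Finset.mul_sum, ← Finset.sum_sub_distrib]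
      refine Finset.sum_congr rfl fun i _ => ?_
      simp only [phiMid, H1.avg]
      ring
    rw [cubicTerm_eq]
    linear_combination e1
  have i12 : Integrable (fun x => (s'.phi x - s.phi x) * deriv psi (phiMid s s' x)
      + c.Cn ^ 2 * (∑ i, (s'.phi.grad i x - s.phi.grad i x) * (phiMid s s').grad i x))
      (volume.restrict Ω) := i1.add (i2.const_mul _)
  rw [← integral_sub (g s' hfin') (g s hfin)]
  simp only [e]
  rw [integral_add i12 (i3.const_mul _), integral_add i1 (i2.const_mul _), integral_const_mul,
    integral_const_mul]
  linear_combination h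

theorem gravity_sub (hΩ : IsOpen Ω) (hb : Bornology.IsBounded Ω) :
    (∫ x in Ω, c.rho (s'.phi x) * height x) - (∫ x in Ω, c.rho (s.phi x) * height x)
      = c.alpha * ∫ x in Ω, (s'.phi x - s.phi x) * height x := by
  have i : ∀ t : State Ω, Integrable (fun x => c.rho (t.phi x) * height x) (volume.restrict Ω) :=
    fun t => (memLp_rho hb t.phi).integrable_mul (memLp_height hΩ hb)
  rw [← integral_sub (i s') (i s), ← integral_const_mul]
  congr 1
  ext x
  simp only [Params.rho]
  ring

/-- The energy law: the momentum equation is tested with `ṽ`, the Cahn-Hilliard equation with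
`μ̃`, and the exchange terms cancel. -/
theorem energy_law (hd : d = 2 ∨ d = 3) (hΩ : IsOpen Ω) (hb : Bornology.IsBounded Ω)
    (hδt : 0 < δt)
    (hfin : IntegrableOn (fun x => psi (s.phi x)) Ω)
    (hfin' : IntegrableOn (fun x => psi (s'.phi x)) Ω)
    (hsol : s.Solenoidal) (hstep : IsStep c δt s s')
    (hgrav : ∫ x in Ω, ∑ i, flux c s s' i x * gravDir i = 0) :
    totalEnergy c s' - totalEnergy c s =
      -δt / c.Re * viscousNormSq c s s'
      - δt / (c.Pe * c.Cn ^ 2 * c.We) * potentialNormSq s s'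
      + 1 / 24 * (1 / (c.We * c.Cn)) *
        (∫ x in Ω, cubicTerm s s' (fun x => (s.phi x + s'.phi x) / 2) x)
      + 1 / 8 * (∫ x in Ω, densityTerm c s s' x) := by
  have hM := hstep.momentum (vMid s s') (vMid_isZeroTrace s s')
  have hCH := hstep.cahnHilliard (muMid s s')
  have hP : ∫ x in Ω, ∑ i, (vMid s s' i).grad i x * pMid s s' x = 0 := by
    simp only [← Finset.sum_mul]
    simp only [mul_comm _ (pMid s s' _)]
    exact solenoidal_mid hsol hstep.solenoidal _
  have hV : ∫ x in Ω, ∑ i, ∑ j, (vMid s s' i).grad j x *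
      (c.eta (phiMid s s' x) * (vMid s s' i).grad j x) = viscousNormSq c s s' := by
    simp only [viscousNormSq, Finset.mul_sum]
    congr 1
    ext x
    exact Finset.sum_congr rfl fun i _ => Finset.sum_congr rfl fun j _ => by ring
  have hN : ∫ x in Ω, ∑ i, (muMid s s').grad i x * (muMid s s').grad i x
      = potentialNormSq s s' := by
    simp only [potentialNormSq, sq]
  have hG : ∫ x in Ω, ∑ i, vMid s s' i x * (c.rho (phiMid s s' x) * gravDir i / c.Fr)
      = 1 / c.Fr * ∫ x in Ω, ∑ i, vMid s s' i x * (c.rho (phiMid s s' x) * gravDir i) := by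
    rw [← integral_const_mul]
    congr 1
    ext x
    rw [Finset.mul_sum]
    exact Finset.sum_congr rfl fun i _ => by ring
  have hμ : ∫ x in Ω, muMid s s' x * ((s'.phi x - s.phi x) / δt)
      = 1 / δt * ∫ x in Ω, (s'.phi x - s.phi x) * muMid s s' x := by
    rw [← integral_const_mul]
    congr 1
    ext x
    ring
  have h1 := kinetic_transport hd hΩ hb hsol hstep
  have h2 := capillary_exchange hd hΩ hb hsol hstep
  have h3 := gravity_exchange hΩ hb hsol hstep hgrav
  have k1 := kinetic_sub (c := c) (s := s) (s' := s') hd hb hδt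
  have k2 := free_energy_sub hstep hfin hfin'
  have k3 := gravity_sub (c := c) (s := s) (s' := s') hΩ hb
  rw [hP, hV, hG] at hM
  rw [hN, hμ, h2] at hCH
  have n1 := c.Re_pos.ne'
  have n2 := c.We_pos.ne'
  have n3 := c.Pe_pos.ne'
  have n4 := c.Cn_pos.ne'
  have n5 := c.Fr_pos.ne'
  have n6 := hδt.ne'
  have expand : totalEnergy c s' - totalEnergy c s
      = 1 / 2 * ((∫ x in Ω, c.rho (s'.phi x) * ∑ i, s'.v i x ^ 2)
          - ∫ x in Ω, c.rho (s.phi x) * ∑ i, s.v i x ^ 2)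
        + 1 / (c.Cn * c.We) *
          ((∫ x in Ω, (psi (s'.phi x) + c.Cn ^ 2 / 2 * ∑ i, s'.phi.grad i x ^ 2))
            - ∫ x in Ω, (psi (s.phi x) + c.Cn ^ 2 / 2 * ∑ i, s.phi.grad i x ^ 2))
        + 1 / c.Fr * ((∫ x in Ω, c.rho (s'.phi x) * height x)
          - ∫ x in Ω, c.rho (s.phi x) * height x) := by
    simp only [totalEnergy]
    ring
  rw [expand, k1, k2, k3]
  linear_combination (norm := (field_simp; ring)) δt * hM + δt / (c.Cn * c.We) * hCH + δt * h1
    + δt / c.Fr * h3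

/-- Energy stability, from the energy law: the remainder terms are at most `δt³` times the
denominator in the restriction on the time step. -/
theorem energy_stable (hb : Bornology.IsBounded Ω) (hδt : 0 < δt) {lam : Eu d → ℝ}
    (hlaw : totalEnergy c s' - totalEnergy c s =
      -δt / c.Re * viscousNormSq c s s'
      - δt / (c.Pe * c.Cn ^ 2 * c.We) * potentialNormSq s s'
      + 1 / 24 * (1 / (c.We * c.Cn)) * (∫ x in Ω, cubicTerm s s' lam x)
      + 1 / 8 * (∫ x in Ω, densityTerm c s s' x))
    {Lphi Lv Pmax : ℝ}
    (hφ : ∀ᵐ x ∂(volume.restrict Ω), |s'.phi x - s.phi x| ≤ Lphi * δt)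
    (hv : ∀ᵐ x ∂(volume.restrict Ω), √(∑ i, (s'.v i x - s.v i x) ^ 2) ≤ Lv * δt)
    (hP : ∀ᵐ x ∂(volume.restrict Ω), 1 / 24 * |iteratedDeriv 3 psi (lam x)| ≤ Pmax)
    (hN : 0 ≤ stepNum c s s')
    (hD : 0 < stepDen c (volume Ω).toReal Lphi Lv Pmax →
      δt ≤ √(stepNum c s s' / stepDen c (volume Ω).toReal Lphi Lv Pmax)) :
    totalEnergy c s' ≤ totalEnergy c s := by
  set m := (volume Ω).toReal with hm
  have hvol : (volume.restrict Ω).real Set.univ = m := by simp [hm, Measure.real]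
  have hfin : IsFiniteMeasure (volume.restrict Ω) := ⟨by simpa using hb.measure_lt_top⟩
  have b1 : ∫ x in Ω, cubicTerm s s' lam x ≤ 24 * Pmax * (Lphi * δt) ^ 3 * m := by
    refine (le_abs_self _).trans ?_
    rw [← hvol, ← Real.norm_eq_abs]
    refine norm_integral_le_of_norm_le_const ?_
    filter_upwards [hφ, hP] with x h1 h2
    rw [cubicTerm, norm_mul, norm_pow, Real.norm_eq_abs, Real.norm_eq_abs]
    exact mul_le_mul (by linarith) (pow_le_pow_left₀ (abs_nonneg _) h1 3) (by positivity)
      (by linarith [abs_nonneg (iteratedDeriv 3 psi (lam x))])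
  have b2 : ∫ x in Ω, densityTerm c s s' x ≤ |c.alpha| * (Lphi * δt) * (Lv * δt) ^ 2 * m := by
    refine (le_abs_self _).trans ?_
    rw [← hvol, ← Real.norm_eq_abs]
    refine norm_integral_le_of_norm_le_const ?_
    filter_upwards [hφ, hv] with x h1 h2
    have h0 : 0 ≤ ∑ i, (s'.v i x - s.v i x) ^ 2 := Finset.sum_nonneg fun i _ => sq_nonneg _
    have h3 : c.rho (s'.phi x) - c.rho (s.phi x) = c.alpha * (s'.phi x - s.phi x) := by
      simp only [Params.rho]
      ring
    have h4 : ∑ i, (s'.v i x - s.v i x) ^ 2 ≤ (Lv * δt) ^ 2 :=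
      (Real.sqrt_le_left ((Real.sqrt_nonneg _).trans h2)).1 h2
    rw [densityTerm, norm_mul, h3, norm_mul, Real.norm_eq_abs, Real.norm_eq_abs, Real.norm_eq_abs,
      abs_of_nonneg h0]
    exact mul_le_mul (mul_le_mul_of_nonneg_left h1 (abs_nonneg _)) h4 h0
      (mul_nonneg (abs_nonneg _) ((abs_nonneg _).trans h1))
  have hWC : 0 < 1 / (c.We * c.Cn) := by
    have := c.We_pos
    have := c.Cn_pos
    positivity
  have b3 := mul_le_mul_of_nonneg_left b1 hWC.le
  have key : totalEnergy c s' - totalEnergy c s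
      ≤ -δt * stepNum c s s' + δt ^ 3 * stepDen c m Lphi Lv Pmax := by
    rw [hlaw]
    calc _ ≤ -δt / c.Re * viscousNormSq c s s'
          - δt / (c.Pe * c.Cn ^ 2 * c.We) * potentialNormSq s s'
          + 1 / 24 * (1 / (c.We * c.Cn) * (24 * Pmax * (Lphi * δt) ^ 3 * m))
          + 1 / 8 * (|c.alpha| * (Lphi * δt) * (Lv * δt) ^ 2 * m) := by linarith
      _ = _ := by
        simp only [stepNum, stepDen]
        ring
  rcases le_or_gt (stepDen c m Lphi Lv Pmax) 0 with h | h
  · have h1 : δt ^ 3 * stepDen c m Lphi Lv Pmax ≤ 0 :=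
      mul_nonpos_of_nonneg_of_nonpos (by positivity) h
    have h2 : 0 ≤ δt * stepNum c s s' := mul_nonneg hδt.le hN
    linarith
  · have h1 : δt ^ 2 ≤ stepNum c s s' / stepDen c m Lphi Lv Pmax :=
      (Real.le_sqrt' hδt).1 (hD h)
    rw [le_div_iff₀ h] at h1
    have h2 := mul_le_mul_of_nonneg_left h1 hδt.le
    linarith

end CHNS

theorem mainTheorem1 {d : ℕ} (hd : d = 2 ∨ d = 3)
    {Ω : Set (EuclideanSpace ℝ (Fin d))} (hopen : IsOpen Ω) (hconn : IsConnected Ω)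
    (hbdd : Bornology.IsBounded Ω)
    (c : CHNS.Params) (δt : ℝ) (hδt : 0 < δt) (s s' : CHNS.State Ω)
    -- both states have finite free energy, and the given velocity is divergence free
    (hfin : IntegrableOn (fun x => CHNS.psi (s.phi x)) Ω)
    (hfin' : IntegrableOn (fun x => CHNS.psi (s'.phi x)) Ω)
    (hsol : s.Solenoidal)
    (hstep : CHNS.IsStep c δt s s')
    -- no net mass flux `J̃` in the direction of gravity: by the divergence theorem this is
    -- the vanishing of `(ρ₋ - ρ₊) / (2 ρ₊ Cn) ∫_{∂Ω} μ̃ ĝ ⋅ n`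
    (hgrav : ∫ x in Ω, ∑ i, CHNS.flux c s s' i x * CHNS.gravDir i = 0) :
    ∃ lam : EuclideanSpace ℝ (Fin d) → ℝ,
      -- `lam` is an intermediate point in the Taylor expansion of `ψ`
      (∀ x ∈ Ω, lam x ∈ Set.uIcc (s.phi x) (s'.phi x) ∧
        CHNS.psi (s'.phi x) - CHNS.psi (s.phi x) =
          deriv CHNS.psi (CHNS.phiMid s s' x) * (s'.phi x - s.phi x)
            + 1 / 24 * CHNS.cubicTerm s s' lam x) ∧
      -- all the integrals in the energy law converge
      CHNS.EnergyDefined c s ∧ CHNS.EnergyDefined c s' ∧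
      IntegrableOn (CHNS.cubicTerm s s' lam) Ω ∧
      IntegrableOn (CHNS.densityTerm c s s') Ω ∧
      -- the energy law
      CHNS.totalEnergy c s' - CHNS.totalEnergy c s =
        -δt / c.Re * CHNS.viscousNormSq c s s'
        - δt / (c.Pe * c.Cn ^ 2 * c.We) * CHNS.potentialNormSq s s'
        + 1 / 24 * (1 / (c.We * c.Cn)) * (∫ x in Ω, CHNS.cubicTerm s s' lam x)
        + 1 / 8 * (∫ x in Ω, CHNS.densityTerm c s s' x) ∧
      -- energy stability under the time-step restriction
      ∀ Lphi Lv Pmax : ℝ,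
        (∀ᵐ x ∂(volume.restrict Ω), |s'.phi x - s.phi x| ≤ Lphi * δt) →
        (∀ᵐ x ∂(volume.restrict Ω), √(∑ i, (s'.v i x - s.v i x) ^ 2) ≤ Lv * δt) →
        (∀ᵐ x ∂(volume.restrict Ω), 1 / 24 * |iteratedDeriv 3 CHNS.psi (lam x)| ≤ Pmax) →
        0 ≤ CHNS.stepNum c s s' →
        -- the restriction is void if its denominator vanishes
        (0 < CHNS.stepDen c (volume Ω).toReal Lphi Lv Pmax →
          δt ≤ √(CHNS.stepNum c s s' /
            CHNS.stepDen c (volume Ω).toReal Lphi Lv Pmax)) →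
        CHNS.totalEnergy c s' ≤ CHNS.totalEnergy c s := by
  refine ⟨fun x => (s.phi x + s'.phi x) / 2, fun x _ => ⟨?_, ?_⟩,
    CHNS.energyDefined hd hopen hbdd hfin, CHNS.energyDefined hd hopen hbdd hfin',
    CHNS.integrable_cubicTerm hstep.defined hfin hfin', CHNS.integrable_densityTerm hd hbdd,
    CHNS.energy_law hd hopen hbdd hδt hfin hfin' hsol hstep hgrav,
    fun Lphi Lv Pmax h1 h2 h3 h4 h5 => CHNS.energy_stable hbdd hδt
      (CHNS.energy_law hd hopen hbdd hδt hfin hfin' hsol hstep hgrav) h1 h2 h3 h4 h5⟩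
  · rcases le_total (s.phi x) (s'.phi x) with h | h
    · rw [Set.uIcc_of_le h]
      exact ⟨by linarith, by linarith⟩
    · rw [Set.uIcc_of_ge h]
      exact ⟨by linarith, by linarith⟩
  · exact CHNS.psi_sub_psi (s.phi x) (s'.phi x)
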